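/- Let $\mathbb{D}$ be the open unit disk in $\mathbb{C}$ and let $H^2$ be the Hilbert space of functions $f(z)=\sum_{n\ge 0}a_nz^n$ on $\mathbb{D}$ with $\|f\|^2=\sum_{n\ge0}|a_n|^2<\infty$. A bounded operator $A$ on a Hilbert space is \emph{posinormal} if $AA^*=A^*PA$ for some positive (semidefinite) operator $P$, and \emph{coposinormal} if $A^*$ is posinormal. Let $\varphi(z)=\frac{az+b}{cz+d}$, with $ad-bc\neq0$, be a nonconstant linear-fractional function that maps $\mathbb{D}$ into $\mathbb{D}$. Then $C_\varphi f=f\circ\varphi$ defines a bounded operator $C_\varphi$ on $H^2$. If $\varphi$ is an automorphism of $\mathbb{D}$ (possibly elliptic), then $C_\varphi$ is both posinormal and coposinormal. Suppose in addition that $w$ is the Denjoy--Wolff point of $\varphi$, that is, $|w|\le 1$, $\varphi(w)=w$, and the iterates of $\varphi$ converge to $w$ uniformly on compact subsets of $\mathbb{D}$ (such a point exists unless $\varphi$ is an elliptic automorphism, including the identity). For $|w|<1$ put $\tau(z)=\frac{w-z}{1-\overline{w}z}$. The operator $C_\varphi$ is posinormal on $H^2$ if and only if at least one of the following holds: \begin{itemize}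 \item $\varphi$ is an automorphism of $\mathbb{D}$; \item $|w|<1$ and there is $\alpha\in\mathbb{C}$ with $|w|<|\alpha|<1$ such that $\varphi(z)=\tau(\alpha\,\tau(z))$ for all $z\in\mathbb{D}$; \item $|w|=1$, $\varphi'(w)=1$, and $\varphi(\beta)=0$ for some $\beta\in\mathbb{D}$; \item $\varphi$ has a fixed point in $\mathbb{D}$ and a fixed point on $\partial\mathbb{D}$, and $\varphi(\beta)=0$ for some $\beta\in\mathbb{D}$. \end{itemize} The operator $C_\varphi$ is coposinormal on $H^2$ if and only if at least one of the following holds: \begin{itemize} \item $\varphi$ is an automorphism of $\mathbb{D}$; \item $|w|=1$; \item $|w|<1$ and there is $\alpha\in\mathbb{C}$ with $0<|\alpha|<1$ such that $\varphi(z)=\tau(\alpha\,\tau(z))$ for all $z\in\mathbb{D}$. \end{itemize} -/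

import Mathlib

open scoped Complex.UnitDisc ENNReal

noncomputable section

/-! ### The Hardy space of the unit disk -/

/-- Square-summable complex sequences `(a₀, a₁, …)`, with `‖a‖² = ∑ |aₙ|²`. -/
abbrev SquareSummable : Type := lp (fun _ : ℕ => ℂ) 2

theorem SquareSummable.summable_powerSeries (a : SquareSummable) (z : 𝔻) :
    Summable fun n : ℕ => a n * (z : ℂ) ^ n := by
  have hz := z.norm_lt_one
  refine Summable.of_norm_bounded (g := fun n : ℕ => ‖a‖ * ‖(z : ℂ)‖ ^ n)
    ((summable_geometric_of_lt_one (norm_nonneg _) hz).mul_left _) fun n => ?_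
  rw [norm_mul, norm_pow]
  exact mul_le_mul_of_nonneg_right (lp.norm_apply_le_norm (by norm_num) a n) (by positivity)

/-- The functions `f(z) = ∑ aₙ zⁿ` on the open unit disk with `∑ |aₙ|² < ∞`. -/
def hardySubmodule : Submodule ℂ (𝔻 → ℂ) where
  carrier := {f | ∃ a : SquareSummable, ∀ z : 𝔻, HasSum (fun n : ℕ => a n * (z : ℂ) ^ n) (f z)}
  add_mem' := by
    rintro f g ⟨a, ha⟩ ⟨b, hb⟩
    refine ⟨a + b, fun z => ?_⟩
    simpa [add_mul] using (ha z).add (hb z)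
  zero_mem' := ⟨0, fun z => by simp⟩
  smul_mem' := by
    rintro c f ⟨a, ha⟩
    refine ⟨c • a, fun z => ?_⟩
    simpa [mul_assoc] using (ha z).mul_left c

/-- The Hardy space `H²` of the open unit disk, as a space of functions on the disk. -/
def HardySpace : Type := hardySubmodule

namespace HardySpace

instance instAddCommGroupHardy : AddCommGroup HardySpace :=
  inferInstanceAs (AddCommGroup hardySubmodule)

instance instModuleHardy : Module ℂ HardySpace :=
  inferInstanceAs (Module ℂ hardySubmodule)

instance instCoeFunHardy : CoeFun HardySpace fun _ => 𝔻 → ℂ := ⟨fun f => f.1⟩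

/-- The function with prescribed Maclaurin coefficients. -/
def ofCoeff : SquareSummable →ₗ[ℂ] HardySpace where
  toFun a := ⟨fun z => ∑' n : ℕ, a n * (z : ℂ) ^ n, a, fun z => (a.summable_powerSeries z).hasSum⟩
  map_add' a b := Subtype.ext <| funext fun z => by
    have h := (a.summable_powerSeries z).hasSum.add (b.summable_powerSeries z).hasSum
    simp only [← add_mul] at h
    exact h.tsum_eq
  map_smul' c a := Subtype.ext <| funext fun z => by
    have h := (a.summable_powerSeries z).hasSum.mul_left c
    simp only [← mul_assoc] at h
    exact h.tsum_eq

theorem ofCoeff_injective : Function.Injective ofCoeff := by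
  rw [injective_iff_map_eq_zero]
  intro a ha
  have h0 : ∀ z : 𝔻, HasSum (fun n : ℕ => a n * (z : ℂ) ^ n) 0 := fun z => by
    have h := (a.summable_powerSeries z).hasSum
    have h1 : ∑' n : ℕ, a n * (z : ℂ) ^ n = 0 := congrFun (congrArg Subtype.val ha) z
    rwa [h1] at h
  have hp : HasFPowerSeriesAt (fun _ : ℂ => (0 : ℂ))
      (FormalMultilinearSeries.ofScalars ℂ fun n => a n) 0 := by
    rw [hasFPowerSeriesAt_iff]
    filter_upwards [Metric.ball_mem_nhds (0 : ℂ) one_pos] with z hz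
    have := h0 (Complex.UnitDisc.mk z (by simpa using hz))
    simpa [FormalMultilinearSeries.coeff_ofScalars, mul_comm] using this
  have hq := hp.eq_zero
  ext n
  have h := congrArg (fun p => FormalMultilinearSeries.coeff p n) hq
  rw [FormalMultilinearSeries.coeff_ofScalars] at h
  rw [h]
  rfl

/-- A function of `H²` corresponds to its sequence of Maclaurin coefficients. -/
def coeffEquiv : HardySpace ≃ₗ[ℂ] SquareSummable :=
  (LinearEquiv.ofBijective ofCoeff ⟨ofCoeff_injective, fun f => by
    obtain ⟨a, ha⟩ := f.2
    exact ⟨a, Subtype.ext <| funext fun z => (ha z).tsum_eq⟩⟩).symm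

theorem hasSum_coeff (f : HardySpace) (z : 𝔻) :
    HasSum (fun n : ℕ => coeffEquiv f n * (z : ℂ) ^ n) (f z) := by
  have h := ((coeffEquiv f).summable_powerSeries z).hasSum
  have h1 : ofCoeff (coeffEquiv f) = f := coeffEquiv.symm_apply_apply f
  have h2 : ∑' n : ℕ, coeffEquiv f n * (z : ℂ) ^ n = f z :=
    congrFun (congrArg Subtype.val h1) z
  rwa [h2] at h

/-- The norm `‖f‖² = ∑ |aₙ|²`. -/
instance instNormedAddCommGroupHardy : NormedAddCommGroup HardySpace :=
  NormedAddCommGroup.induced HardySpace SquareSummable coeffEquiv coeffEquiv.injective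

/-- The inner product of two functions is that of their coefficient sequences. -/
instance instInnerProductSpaceHardy : InnerProductSpace ℂ HardySpace where
  norm_smul_le c f := by
    change ‖coeffEquiv (c • f)‖ ≤ ‖c‖ * ‖coeffEquiv f‖
    rw [map_smul]
    exact norm_smul_le _ _
  inner f g := inner ℂ (coeffEquiv f) (coeffEquiv g)
  norm_sq_eq_re_inner f := norm_sq_eq_re_inner (𝕜 := ℂ) (coeffEquiv f)
  conj_inner_symm f g := inner_conj_symm (coeffEquiv f) (coeffEquiv g)
  add_left f g h := by rw [map_add]; exact inner_add_left _ _ _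
  smul_left f g c := by rw [map_smul]; exact inner_smul_left _ _ _

/-- `coeffEquiv` as an isometry. -/
def coeffIsometry : HardySpace ≃ₗᵢ[ℂ] SquareSummable := ⟨coeffEquiv, fun _ => rfl⟩

instance instCompleteSpaceHardy : CompleteSpace HardySpace :=
  (completeSpace_congr (e := coeffIsometry.toEquiv)
    coeffIsometry.isometry.isUniformEmbedding).mpr inferInstance

theorem norm_sq_eq_tsum (f : HardySpace) : ‖f‖ ^ 2 = ∑' n : ℕ, ‖coeffEquiv f n‖ ^ 2 := by
  have h := lp.norm_rpow_eq_tsum (p := 2) (by norm_num) (coeffEquiv f)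
  have h1 : ‖f‖ = ‖coeffEquiv f‖ := rfl
  rw [h1]
  simpa using h

end HardySpace

open Classical in
/-- The composition operator `C_ψ f = f ∘ ψ` on `H²`. A bounded operator satisfying this equation
is unique if it exists; the definition is completed by `0` when none exists. -/
def compositionOperator (ψ : 𝔻 → 𝔻) : HardySpace →L[ℂ] HardySpace :=
  if h : ∃ C : HardySpace →L[ℂ] HardySpace, ∀ (f : HardySpace) (z : 𝔻), C f z = f (ψ z)
  then h.choose else 0

theorem compositionOperator_eq {ψ : 𝔻 → 𝔻} {C : HardySpace →L[ℂ] HardySpace}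
    (hC : ∀ (f : HardySpace) (z : 𝔻), C f z = f (ψ z)) : compositionOperator ψ = C := by
  have h : ∃ C : HardySpace →L[ℂ] HardySpace, ∀ (f : HardySpace) (z : 𝔻), C f z = f (ψ z) :=
    ⟨C, hC⟩
  rw [compositionOperator, dif_pos h]
  ext f
  exact Subtype.ext <| funext fun z => (h.choose_spec f z).trans (hC f z).symm

/-! ### Posinormal and coposinormal operators -/

section Posinormal

variable {H : Type*} [NormedAddCommGroup H] [InnerProductSpace ℂ H] [CompleteSpace H]

/-- `A` is posinormal: `A A* = A* P A` for some positive operator `P`. -/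
def IsPosinormal (A : H →L[ℂ] H) : Prop :=
  ∃ P : H →L[ℂ] H, P.IsPositive ∧
    A ∘L ContinuousLinearMap.adjoint A = ContinuousLinearMap.adjoint A ∘L P ∘L A

/-- `A` is coposinormal: its adjoint is posinormal. -/
def IsCoposinormal (A : H →L[ℂ] H) : Prop :=
  IsPosinormal (ContinuousLinearMap.adjoint A)

end Posinormal

/-! ### Linear-fractional selfmaps of the disk -/

/-- The linear-fractional function `z ↦ (a z + b) / (c z + d)`. -/
def linearFractional (a b c d : ℂ) : ℂ → ℂ := fun z => (a * z + b) / (c * z + d)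

/-- `φ` agrees with a nonconstant linear-fractional function without pole in the open unit disk,
and maps the open unit disk into itself. -/
structure IsLinearFractionalSelfmap (φ : ℂ → ℂ) : Prop where
  exists_eq : ∃ a b c d : ℂ, a * d - b * c ≠ 0 ∧ (∀ z : ℂ, ‖z‖ < 1 → c * z + d ≠ 0) ∧
    φ = linearFractional a b c d
  norm_lt_one : ∀ z : ℂ, ‖z‖ < 1 → ‖φ z‖ < 1

/-- The selfmap of the unit disk obtained from `φ` by restriction. -/
def IsLinearFractionalSelfmap.toDisc {φ : ℂ → ℂ} (hφ : IsLinearFractionalSelfmap φ) : 𝔻 → 𝔻 :=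
  fun z => Complex.UnitDisc.mk (φ z) (hφ.norm_lt_one z z.norm_lt_one)

/-- `φ` is an automorphism of the open unit disk (for `φ` holomorphic on the disk): it maps the
disk bijectively onto itself. -/
def IsDiskAutomorphism (φ : ℂ → ℂ) : Prop :=
  Set.BijOn φ (Metric.ball 0 1) (Metric.ball 0 1)

/-- `w` is the Denjoy–Wolff point of `φ`: a fixed point in the closed disk to which the iterates
of `φ` converge, uniformly on compact subsets of the open disk. -/
structure IsDenjoyWolffPoint (φ : ℂ → ℂ) (w : ℂ) : Prop where
  norm_le_one : ‖w‖ ≤ 1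
  fixed : φ w = w
  tendsto_iterate : TendstoLocallyUniformlyOn (fun (n : ℕ) (z : ℂ) => φ^[n] z) (fun _ => w)
    Filter.atTop (Metric.ball 0 1)

/-- The map `τ(z) = (w - z) / (1 - w̄ z)`, a self-inverse disk automorphism when `|w| < 1`. -/
def diskInvolution (w : ℂ) : ℂ → ℂ := fun z => (w - z) / (1 - starRingEnd ℂ w * z)

/-- On the open unit disk, `φ = τ ∘ ατ` with `τ(z) = (w - z) / (1 - w̄ z)`. -/
def IsConjugateOfDilation (φ : ℂ → ℂ) (w α : ℂ) : Prop :=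
  ∀ z : ℂ, ‖z‖ < 1 → φ z = diskInvolution w (α * diskInvolution w z)

/-- `φ` vanishes somewhere in the open unit disk. -/
def VanishesInDisk (φ : ℂ → ℂ) : Prop := ∃ β : ℂ, ‖β‖ < 1 ∧ φ β = 0

end

/-! By Douglas factorization, `A` is posinormal exactly when `A = A* X` for a bounded `X`, which is
the same as the range of `A` lying inside that of `A*`. Write `φ(z) = (az+b)/(cz+d)` with matrix
`M`. Cowen's formula (`mul_adjoint_compositionOperator_apply`) gives `C_φ* = M_g C_σ M_h*`, where `g
= 1/(-b̄z+d̄)`, `h = cz+d`, and `σ`, the map of `sharp M`, is again a selfmap of the disk. Since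
`M_h*` is invertible, solving `C_φ* u = C_φ f` means finding `v ∈ H²` with `v∘σ = (-b̄z+d̄)·(f∘φ)`,
that is, `v(y) = conj(det M)/(b̄y+ā) · f(χ(y))` with `χ = φ∘σ⁻¹`.

This is solvable for every `f` iff `|b| < |a|` (`φ` vanishes in the disk) and `χ` maps the disk into
itself. Sufficiency is explicit: such a `χ` induces a bounded operator and `1/(b̄y+ā)` is a bounded
multiplier. For necessity take `f` to be a reproducing kernel: `v` is then rational, and a function
of `H²` has no pole in the closed disk (`eq_zero_of_mul_eq`). In the same way, `C_φ` is coposinormal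
iff `ψ = σ∘φ⁻¹` maps the disk into itself. The result is `isPosinormal_compositionOperator_iff` and
`isCoposinormal_compositionOperator_iff`.

The rest is algebra of 2×2 matrices in two normal forms. If `|w| < 1`, conjugation by the involution
`τ` turns `φ` into `az/(cz+1)`. Then `χ` is a selfmap iff `c = 0` (a dilation) or `|1-a| = |c|` (the
second fixed point `(a-1)/c` is on the circle), and `ψ` is one iff `c = 0`. If `|w| = 1`, passage to
the right half-plane turns `φ` into `lz+μ` with `l > 0`, `Re μ ≥ 0` and `φ'(w) = 1/l`. There `χ` and
`ψ` are again affine, and they are selfmaps iff `(1-l) Re μ ≥ 0` and `(l-1) Re μ ≥ 0` respectively.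
Being the Denjoy–Wolff point forces `l ≥ 1` or `Re μ = 0`, and `Re μ = 0` is the automorphism case.
-/

open ComplexConjugate

/-! ### Series along the orbit of a contraction -/

section ContractionSeries

variable {H : Type*} [NormedAddCommGroup H] [InnerProductSpace ℂ H]

/-- Split the sum as `a₀ k + T(rest)`. The two terms are orthogonal and `T` is a contraction, so
Pythagoras and induction give the bound, although the vectors `Tⁿ k` need not be mutually
orthogonal. -/
theorem norm_sum_range_smul_pow_apply_sq_le {T : H →L[ℂ] H} (hT : ∀ x, ‖T x‖ ≤ ‖x‖) {k : H}
    (hk : ∀ x, inner ℂ k (T x) = 0) (N : ℕ) (a : ℕ → ℂ) :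
    ‖∑ n ∈ Finset.range N, a n • (T ^ n) k‖ ^ 2 ≤ ‖k‖ ^ 2 * ∑ n ∈ Finset.range N, ‖a n‖ ^ 2 := by
  induction N generalizing a with
  | zero => simp
  | succ N ih =>
    have h1 : ∑ n ∈ Finset.range (N + 1), a n • (T ^ n) k
        = a 0 • k + T (∑ n ∈ Finset.range N, a (n + 1) • (T ^ n) k) := by
      rw [Finset.sum_range_succ', map_sum, add_comm]
      simp [pow_succ']
    have h2 := hT (∑ n ∈ Finset.range N, a (n + 1) • (T ^ n) k)
    have h3 := ih fun n => a (n + 1)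
    rw [h1, norm_add_sq (𝕜 := ℂ), inner_smul_left, hk, Finset.sum_range_succ', norm_smul]
    have h4 := pow_le_pow_left₀ (norm_nonneg _) h2 2
    simp only [mul_zero, map_zero]
    nlinarith

theorem norm_sum_smul_pow_apply_sq_le {T : H →L[ℂ] H} (hT : ∀ x, ‖T x‖ ≤ ‖x‖) {k : H}
    (hk : ∀ x, inner ℂ k (T x) = 0) (s : Finset ℕ) (a : ℕ → ℂ) :
    ‖∑ n ∈ s, a n • (T ^ n) k‖ ^ 2 ≤ ‖k‖ ^ 2 * ∑ n ∈ s, ‖a n‖ ^ 2 := by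
  obtain ⟨N, hN⟩ := s.exists_nat_subset_range
  have h := norm_sum_range_smul_pow_apply_sq_le hT hk N fun n => if n ∈ s then a n else 0
  have e1 : ∑ n ∈ Finset.range N, (if n ∈ s then a n else 0) • (T ^ n) k
      = ∑ n ∈ s, a n • (T ^ n) k := by
    simp only [ite_smul, zero_smul]
    rw [← Finset.sum_filter, Finset.filter_mem_eq_inter, Finset.inter_eq_right.mpr hN]
  have e2 : ∑ n ∈ Finset.range N, ‖if n ∈ s then a n else 0‖ ^ 2 = ∑ n ∈ s, ‖a n‖ ^ 2 := by
    simp only [apply_ite (fun x : ℂ => ‖x‖ ^ 2), norm_zero, ne_eq, OfNat.ofNat_ne_zero,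
      not_false_eq_true, zero_pow]
    rw [← Finset.sum_filter, Finset.filter_mem_eq_inter, Finset.inter_eq_right.mpr hN]
  rwa [e1, e2] at h

theorem SquareSummable.hasSum_norm_sq (a : SquareSummable) :
    HasSum (fun n => ‖a n‖ ^ 2) (‖a‖ ^ 2) := by
  simpa using lp.hasSum_norm (p := 2) (by norm_num) a

theorem summable_smul_pow_apply [CompleteSpace H] {T : H →L[ℂ] H} (hT : ∀ x, ‖T x‖ ≤ ‖x‖) {k : H}
    (hk : ∀ x, inner ℂ k (T x) = 0) (a : SquareSummable) :
    Summable fun n => a n • (T ^ n) k := by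
  rw [summable_iff_vanishing_norm]
  intro ε hε
  have hs := a.hasSum_norm_sq.summable
  obtain ⟨s, hs⟩ := summable_iff_vanishing_norm.mp hs (ε ^ 2 / (‖k‖ ^ 2 + 1)) (by positivity)
  refine ⟨s, fun t ht => ?_⟩
  have h1 := hs t ht
  have h2 := norm_sum_smul_pow_apply_sq_le hT hk t a
  rw [Real.norm_of_nonneg (by positivity), lt_div_iff₀ (by positivity)] at h1
  have h3 : 0 ≤ ∑ n ∈ t, ‖a n‖ ^ 2 := by positivity
  refine lt_of_pow_lt_pow_left₀ 2 hε.le ?_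
  nlinarith

/-- If `T` is a contraction whose range is orthogonal to `k`, then square-summable combinations of
the vectors `Tⁿ k` converge and depend boundedly on the coefficients. -/
theorem exists_clm_hasSum_smul_pow_apply [CompleteSpace H] {T : H →L[ℂ] H}
    (hT : ∀ x, ‖T x‖ ≤ ‖x‖) {k : H} (hk : ∀ x, inner ℂ k (T x) = 0) :
    ∃ L : SquareSummable →L[ℂ] H, ∀ a, HasSum (fun n => a n • (T ^ n) k) (L a) := by
  have hs := summable_smul_pow_apply hT hk
  let L : SquareSummable →ₗ[ℂ] H :=
    { toFun := fun a => ∑' n, a n • (T ^ n) k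
      map_add' := fun a b => by
        rw [← (hs a).tsum_add (hs b)]
        simp [add_smul]
      map_smul' := fun c a => by
        rw [RingHom.id_apply, ← (hs a).tsum_const_smul]
        simp [mul_smul] }
  refine ⟨L.mkContinuous ‖k‖ fun a => ?_, fun a => (hs a).hasSum⟩
  have h1 : Filter.Tendsto (fun s : Finset ℕ => ‖∑ n ∈ s, a n • (T ^ n) k‖ ^ 2) Filter.atTop
      (nhds (‖L a‖ ^ 2)) := ((hs a).hasSum.norm).pow 2
  have h2 : Filter.Tendsto (fun s : Finset ℕ => ‖k‖ ^ 2 * ∑ n ∈ s, ‖a n‖ ^ 2) Filter.atTop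
      (nhds (‖k‖ ^ 2 * ‖a‖ ^ 2)) := a.hasSum_norm_sq.const_mul _
  have h3 := le_of_tendsto_of_tendsto' h1 h2 fun s => norm_sum_smul_pow_apply_sq_le hT hk s a
  rw [← mul_pow] at h3
  exact le_of_sq_le_sq h3 (by positivity)

end ContractionSeries

/-! ### Reproducing kernels and linear multipliers on `H²` -/

noncomputable section

namespace HardySpace

theorem ext {f g : HardySpace} (h : ∀ z : 𝔻, f z = g z) : f = g := Subtype.ext (funext h)

theorem add_apply (f g : HardySpace) (z : 𝔻) : (f + g) z = f z + g z := rfl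

theorem smul_apply (c : ℂ) (f : HardySpace) (z : 𝔻) : (c • f) z = c * f z := rfl

theorem coeffEquiv_ofCoeff (a : SquareSummable) : coeffEquiv (ofCoeff a) = a :=
  coeffEquiv.apply_symm_apply a

theorem inner_def (f g : HardySpace) : inner ℂ f g = inner ℂ (coeffEquiv f) (coeffEquiv g) := rfl

/-- The reproducing kernel of `H²` at a point of the disk. -/
def kernel (w : 𝔻) : HardySpace :=
  ofCoeff ⟨fun n => conj (w : ℂ) ^ n, memℓp_gen (by
    have h : ‖(w : ℂ)‖ ^ 2 < 1 := w.sq_norm_lt_one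
    simpa [← pow_mul, mul_comm] using summable_geometric_of_lt_one (by positivity) h)⟩

theorem inner_kernel (w : 𝔻) (f : HardySpace) : inner ℂ (kernel w) f = f w := by
  rw [inner_def, kernel, coeffEquiv_ofCoeff, lp.inner_eq_tsum]
  simpa using (hasSum_coeff f w).tsum_eq

theorem kernel_mul_apply (w z : 𝔻) : (1 - conj (w : ℂ) * z) * kernel w z = 1 := by
  have h := hasSum_coeff (kernel w) z
  simp only [kernel, coeffEquiv_ofCoeff, ← mul_pow] at h
  have hlt : ‖conj (w : ℂ) * z‖ < 1 := by
    rw [norm_mul, RCLike.norm_conj]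
    exact mul_lt_one_of_nonneg_of_lt_one_left (norm_nonneg _) w.norm_lt_one z.norm_lt_one.le
  rw [kernel, h.unique (hasSum_geometric_of_norm_lt_one hlt)]
  refine mul_inv_cancel₀ fun h0 => ?_
  rw [sub_eq_zero] at h0
  rw [← h0] at hlt
  simp at hlt

theorem kernel_zero_apply (z : 𝔻) : kernel 0 z = 1 := by
  simpa using kernel_mul_apply 0 z

/-- Cauchy–Schwarz against the kernel, with `‖k_z‖² = 1/(1-|z|²)`. This growth bound is what
excludes poles on the unit circle. -/
theorem norm_apply_sq_mul_le (f : HardySpace) (z : 𝔻) :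
    ‖f z‖ ^ 2 * (1 - ‖(z : ℂ)‖ ^ 2) ≤ ‖f‖ ^ 2 := by
  have h1 : ‖f z‖ ≤ ‖kernel z‖ * ‖f‖ := by
    rw [← inner_kernel]
    exact norm_inner_le_norm _ _
  have h2 : (1 - ‖(z : ℂ)‖ ^ 2) * ‖kernel z‖ ^ 2 = 1 := by
    have h := kernel_mul_apply z z
    rw [← inner_kernel, inner_self_eq_norm_sq_to_K, mul_comm (conj _), Complex.mul_conj,
      Complex.normSq_eq_norm_sq, Complex.ofReal_pow] at h
    refine Complex.ofReal_injective ?_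
    push_cast
    exact h
  have h3 : 0 ≤ 1 - ‖(z : ℂ)‖ ^ 2 := by linarith [z.sq_norm_lt_one]
  calc ‖f z‖ ^ 2 * (1 - ‖(z : ℂ)‖ ^ 2) ≤ (‖kernel z‖ * ‖f‖) ^ 2 * (1 - ‖(z : ℂ)‖ ^ 2) := by
        gcongr
    _ = (1 - ‖(z : ℂ)‖ ^ 2) * ‖kernel z‖ ^ 2 * ‖f‖ ^ 2 := by ring
    _ = ‖f‖ ^ 2 := by rw [h2, one_mul]

theorem hasSum_apply {ι : Type*} {u : ι → HardySpace} {f : HardySpace} (h : HasSum u f) (z : 𝔻) :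
    HasSum (fun i => u i z) (f z) := by
  have := (innerSL ℂ (kernel z)).hasSum h
  simpa [inner_kernel] using this

/-- Bounded operators on `H²` that agree on reproducing kernels are equal. -/
theorem clm_ext_kernel {A B : HardySpace →L[ℂ] HardySpace}
    (h : ∀ z, A (kernel z) = B (kernel z)) : A = B := by
  have h1 : ContinuousLinearMap.adjoint A = ContinuousLinearMap.adjoint B := by
    ext f
    refine HardySpace.ext fun z => ?_
    rw [← inner_kernel, ← inner_kernel, ContinuousLinearMap.adjoint_inner_right,
      ContinuousLinearMap.adjoint_inner_right, h]
  exact ContinuousLinearMap.adjoint.injective h1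

/-- The sequence `(0, a₀, a₁, …)`. -/
def shiftSeq (a : SquareSummable) : SquareSummable :=
  ⟨fun n => Nat.casesOn n 0 fun m => a m, memℓp_gen (by
    rw [← summable_nat_add_iff 1]
    simpa using a.hasSum_norm_sq.summable)⟩

theorem shiftSeq_zero (a : SquareSummable) : shiftSeq a 0 = 0 := rfl

theorem shiftSeq_succ (a : SquareSummable) (n : ℕ) : shiftSeq a (n + 1) = a n := rfl

theorem norm_shiftSeq (a : SquareSummable) : ‖shiftSeq a‖ = ‖a‖ := by
  have h1 := (shiftSeq a).hasSum_norm_sq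
  rw [← hasSum_nat_add_iff' 1] at h1
  simp only [shiftSeq_succ, Finset.range_one, Finset.sum_singleton, shiftSeq_zero, norm_zero,
    ne_eq, OfNat.ofNat_ne_zero, not_false_eq_true, zero_pow, sub_zero] at h1
  have h2 := h1.unique a.hasSum_norm_sq
  exact (sq_eq_sq₀ (norm_nonneg _) (norm_nonneg _)).mp h2

/-- Multiplication by the variable on `H²`. -/
def shift : HardySpace →ₗᵢ[ℂ] HardySpace where
  toFun f := ofCoeff (shiftSeq (coeffEquiv f))
  map_add' f g := by
    rw [← map_add, map_add]
    congr 1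
    ext n
    cases n <;> simp [shiftSeq_zero, shiftSeq_succ]
  map_smul' c f := by
    rw [RingHom.id_apply, ← map_smul, map_smul]
    congr 1
    ext n
    cases n <;> simp [shiftSeq_zero, shiftSeq_succ]
  norm_map' f := by
    change ‖coeffEquiv (ofCoeff (shiftSeq (coeffEquiv f)))‖ = ‖coeffEquiv f‖
    rw [coeffEquiv_ofCoeff, norm_shiftSeq]

theorem shift_apply (f : HardySpace) (z : 𝔻) : shift f z = z * f z := by
  have h1 := hasSum_coeff (ofCoeff (shiftSeq (coeffEquiv f))) z
  rw [coeffEquiv_ofCoeff, ← hasSum_nat_add_iff' 1] at h1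
  simp only [shiftSeq_succ, Finset.range_one, Finset.sum_singleton, shiftSeq_zero, zero_mul,
    sub_zero] at h1
  refine h1.unique ?_
  simpa [pow_succ', mul_left_comm] using (hasSum_coeff f z).mul_left (z : ℂ)

/-- Multiplication by `c z + d` on `H²`. -/
def mulLinear (c d : ℂ) : HardySpace →L[ℂ] HardySpace :=
  c • shift.toContinuousLinearMap + d • ContinuousLinearMap.id ℂ HardySpace

theorem mulLinear_eq (c d : ℂ) (f : HardySpace) : mulLinear c d f = c • shift f + d • f := rfl

theorem mulLinear_apply (c d : ℂ) (f : HardySpace) (z : 𝔻) :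
    mulLinear c d f z = (c * z + d) * f z := by
  rw [mulLinear_eq, add_apply, smul_apply, smul_apply, shift_apply]
  ring

/-- Neumann series: the shift is an isometry, so `(c/d)·shift` has norm less than one. -/
theorem isUnit_mulLinear {c d : ℂ} (h : ‖c‖ < ‖d‖) : IsUnit (mulLinear c d) := by
  have hd : d ≠ 0 := norm_pos_iff.mp ((norm_nonneg c).trans_lt h)
  have hS : ‖(-(c / d)) • shift.toContinuousLinearMap‖ < 1 := by
    rw [norm_smul]
    have h1 : ‖shift.toContinuousLinearMap‖ ≤ 1 := shift.norm_toContinuousLinearMap_le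
    have h2 : ‖-(c / d)‖ < 1 := by
      rw [norm_neg, norm_div, div_lt_one (norm_pos_iff.mpr hd)]
      exact h
    exact mul_lt_one_of_nonneg_of_lt_one_left (norm_nonneg _) h2 h1
  have h1 := isUnit_one_sub_of_norm_lt_one hS
  have h2 : mulLinear c d = Units.mk0 d hd • (1 - (-(c / d)) • shift.toContinuousLinearMap) := by
    ext f
    change c • shift f + d • f = d • (f - (-(c / d)) • shift f)
    rw [smul_sub, smul_smul]
    have : d * -(c / d) = -c := by field_simp
    rw [this, neg_smul, sub_neg_eq_add, add_comm]
  rw [h2]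
  exact h1.smul _

/-- Multiplication by `1 / (c z + d)` on `H²`, when the pole is outside the closed disk. -/
def divLinear (c d : ℂ) : HardySpace →L[ℂ] HardySpace := Ring.inverse (mulLinear c d)

theorem mulLinear_divLinear {c d : ℂ} (h : ‖c‖ < ‖d‖) (f : HardySpace) :
    mulLinear c d (divLinear c d f) = f := by
  have := congrArg (fun A : HardySpace →L[ℂ] HardySpace => A f)
    (Ring.mul_inverse_cancel _ (isUnit_mulLinear h))
  exact this

theorem divLinear_apply {c d : ℂ} (h : ‖c‖ < ‖d‖) (f : HardySpace) (z : 𝔻) :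
    (c * z + d) * divLinear c d f z = f z := by
  rw [← mulLinear_apply, mulLinear_divLinear h]

/-- The shift `S` is an isometry, so `‖(az+b)f‖² = (|a|²+|b|²)‖f‖² + 2 Re(ā b ⟨Sf, f⟩)`. The
difference of the two squared norms is therefore `E‖f‖² + 2 Re(κ⟨Sf, f⟩)`, and it is nonnegative
because `|⟨Sf, f⟩| ≤ ‖f‖²` and `2|κ| ≤ E`. No boundary values of `f` are needed. -/
theorem norm_mulLinear_le {a b c d : ℂ} (h : ∀ z : ℂ, ‖z‖ = 1 → ‖a * z + b‖ ≤ ‖c * z + d‖)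
    (f : HardySpace) : ‖mulLinear a b f‖ ≤ ‖mulLinear c d f‖ := by
  set κ : ℂ := conj c * d - conj a * b with hκ
  set E : ℝ := ‖c‖ ^ 2 + ‖d‖ ^ 2 - ‖a‖ ^ 2 - ‖b‖ ^ 2 with hE
  have key : ∀ p q : ℂ, ∀ x y : HardySpace, ‖p • x + q • y‖ ^ 2
      = ‖p‖ ^ 2 * ‖x‖ ^ 2 + 2 * (conj p * q * inner ℂ x y).re + ‖q‖ ^ 2 * ‖y‖ ^ 2 := by
    intro p q x y
    rw [norm_add_sq (𝕜 := ℂ), inner_smul_left, inner_smul_right, norm_smul, norm_smul, mul_pow,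
      mul_pow, ← mul_assoc]
    rfl
  have hcirc : 2 * ‖κ‖ ≤ E := by
    -- The worst point of the circle, where `Re(κ z̄)` is least; the pointwise hypothesis there is
    -- exactly `2|κ| ≤ E`.
    have hz : ∃ z : ℂ, ‖z‖ = 1 ∧ (κ * conj z).re = -‖κ‖ := by
      rcases eq_or_ne κ 0 with h0 | h0
      · exact ⟨1, by simp, by simp [h0]⟩
      · have hn : (‖κ‖ : ℂ) ≠ 0 := by exact_mod_cast norm_ne_zero_iff.mpr h0
        refine ⟨-(κ / ‖κ‖), by simp [h0], ?_⟩
        have : κ * conj (-(κ / ‖κ‖)) = ((-‖κ‖ : ℝ) : ℂ) := by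
          rw [map_neg, map_div₀, Complex.conj_ofReal, mul_neg, mul_div_assoc', Complex.mul_conj,
            Complex.normSq_eq_norm_sq]
          push_cast
          field_simp
        rw [this, Complex.ofReal_re]
    obtain ⟨z, hz, hzκ⟩ := hz
    have h1 := pow_le_pow_left₀ (norm_nonneg _) (h z hz) 2
    have e : ∀ p q : ℂ, ‖p * z + q‖ ^ 2 = ‖p‖ ^ 2 + 2 * (conj p * q * conj z).re + ‖q‖ ^ 2 := by
      intro p q
      have hz2 : Complex.normSq z = 1 := by rw [Complex.normSq_eq_norm_sq, hz, one_pow]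
      rw [← Complex.normSq_eq_norm_sq, ← Complex.normSq_eq_norm_sq, ← Complex.normSq_eq_norm_sq,
        Complex.normSq_add, Complex.normSq_mul, hz2]
      have : p * z * conj q = conj (conj p * q * conj z) := by
        simp only [map_mul, Complex.conj_conj]; ring
      rw [this, Complex.conj_re]
      ring
    rw [e, e] at h1
    have : (κ * conj z).re = (conj c * d * conj z).re - (conj a * b * conj z).re := by
      rw [hκ, sub_mul, Complex.sub_re]
    linarith
  have hin : -(‖κ‖ * ‖f‖ ^ 2) ≤ (κ * inner ℂ (shift f) f).re := by
    have h1 : ‖κ * inner ℂ (shift f) f‖ ≤ ‖κ‖ * ‖f‖ ^ 2 := by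
      rw [norm_mul]
      gcongr
      refine (norm_inner_le_norm _ _).trans_eq ?_
      rw [shift.norm_map, sq]
    have h2 := (abs_le.mp (Complex.abs_re_le_norm (κ * inner ℂ (shift f) f))).1
    linarith
  have h3 : (κ * inner ℂ (shift f) f).re
      = (conj c * d * inner ℂ (shift f) f).re - (conj a * b * inner ℂ (shift f) f).re := by
    rw [hκ, sub_mul, Complex.sub_re]
  refine le_of_sq_le_sq ?_ (norm_nonneg _)
  rw [mulLinear_eq, mulLinear_eq, key, key, shift.norm_map]
  nlinarith [mul_le_mul_of_nonneg_right hcirc (sq_nonneg ‖f‖)]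

end HardySpace

end

/-! ### Posinormality and ranges -/

section Posinormal

variable {H : Type*} [NormedAddCommGroup H] [InnerProductSpace ℂ H] [CompleteSpace H]

open ContinuousLinearMap in
-- The easy half of Douglas's lemma: taking adjoints gives `A* = X* A`, so `AA* = A*(XX*)A`.
theorem isPosinormal_of_eq_adjoint_comp {A X : H →L[ℂ] H} (h : A = adjoint A ∘L X) :
    IsPosinormal A := by
  refine ⟨X ∘L adjoint X, isPositive_self_comp_adjoint X, ?_⟩
  have h2 : adjoint A = adjoint X ∘L A := by
    conv_lhs => rw [h, adjoint_comp, adjoint_adjoint]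
  calc A ∘L adjoint A = (adjoint A ∘L X) ∘L adjoint A := by rw [← h]
    _ = (adjoint A ∘L X) ∘L (adjoint X ∘L A) := by rw [← h2]
    _ = _ := rfl

open ContinuousLinearMap in
theorem isPosinormal_of_leftInverse_of_rightInverse {A B : H →L[ℂ] H}
    (hAB : ∀ x, A (B x) = x) (hBA : ∀ x, B (A x) = x) :
    IsPosinormal A ∧ IsCoposinormal A := by
  have e1 : A ∘L B = ContinuousLinearMap.id ℂ H := by ext x; exact hAB x
  have e2 : B ∘L A = ContinuousLinearMap.id ℂ H := by ext x; exact hBA x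
  have e3 : adjoint A ∘L adjoint B = ContinuousLinearMap.id ℂ H := by
    rw [← adjoint_comp, e2, adjoint_id]
  constructor
  · refine isPosinormal_of_eq_adjoint_comp (X := adjoint B ∘L A) ?_
    rw [← ContinuousLinearMap.comp_assoc, e3, ContinuousLinearMap.id_comp]
  · refine isPosinormal_of_eq_adjoint_comp (X := B ∘L adjoint A) ?_
    rw [adjoint_adjoint, ← ContinuousLinearMap.comp_assoc, e1, ContinuousLinearMap.id_comp]

open ContinuousLinearMap in
/-- A posinormal operator has range inside that of its adjoint. -/
theorem IsPosinormal.exists_adjoint_apply_eq {A : H →L[ℂ] H} (hA : IsPosinormal A) (x : H) :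
    ∃ u, adjoint A u = A x := by
  obtain ⟨P, hP, h⟩ := hA
  have hbound : ∀ f, ‖adjoint A f‖ ^ 2 ≤ ‖P‖ * ‖A f‖ ^ 2 := fun f => by
    have h1 : inner ℂ (adjoint A f) (adjoint A f) = inner ℂ (A f) (P (A f)) := by
      have h2 := congrArg (fun B : H →L[ℂ] H => B f) h
      simp only [comp_apply] at h2
      rw [adjoint_inner_left, h2, adjoint_inner_right]
    have h3 : ‖adjoint A f‖ ^ 2 = ‖inner ℂ (A f) (P (A f))‖ := by
      rw [← h1, inner_self_eq_norm_sq_to_K]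
      simp
    rw [h3]
    calc ‖inner ℂ (A f) (P (A f))‖ ≤ ‖A f‖ * ‖P (A f)‖ := norm_inner_le_norm _ _
      _ ≤ ‖A f‖ * (‖P‖ * ‖A f‖) := by gcongr; exact P.le_opNorm _
      _ = ‖P‖ * ‖A f‖ ^ 2 := by ring
  have hbound' : ∀ f, ‖adjoint A f‖ ≤ √‖P‖ * ‖A f‖ := fun f => by
    refine le_of_sq_le_sq ?_ (by positivity)
    rw [mul_pow, Real.sq_sqrt (norm_nonneg _)]
    exact hbound f
  let ℓ : H →ₗ[ℂ] ℂ := (innerSL ℂ (A x) : H →L[ℂ] ℂ).toLinearMap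
  have hℓ : ∀ f, ℓ f = inner ℂ x (adjoint A f) := fun f => by
    rw [adjoint_inner_right]
    rfl
  -- The bound shows that `A f = 0` forces `A* f = 0`, so `f ↦ ⟨x, A* f⟩` factors through `A`. The
  -- factor is bounded on the range of `A`; Hahn–Banach extends it, and Riesz represents it by the
  -- required `u`.
  have hmem : ℓ ∈ LinearMap.range A.toLinearMap.dualMap := by
    rw [LinearMap.range_dualMap_eq_dualAnnihilator_ker, Submodule.mem_dualAnnihilator]
    intro f hf
    have hf' : A f = 0 := hf
    have h4 := hbound' f
    rw [hf', norm_zero, mul_zero] at h4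
    rw [hℓ, norm_le_zero_iff.mp h4, inner_zero_right]
  obtain ⟨m, hm⟩ := hmem
  have hm' : ∀ f, m (A f) = inner ℂ x (adjoint A f) := fun f => by
    rw [← hℓ, ← hm]
    rfl
  let m' : LinearMap.range A.toLinearMap →L[ℂ] ℂ :=
    (m.domRestrict (LinearMap.range A.toLinearMap)).mkContinuous (‖x‖ * √‖P‖) (by
      rintro ⟨_, f, rfl⟩
      change ‖m (A f)‖ ≤ ‖x‖ * √‖P‖ * ‖A f‖
      rw [hm', mul_assoc]
      exact (norm_inner_le_norm _ _).trans (by gcongr; exact hbound' f))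
  obtain ⟨g, hg, -⟩ := exists_extension_norm_eq _ m'
  refine ⟨(InnerProductSpace.toDual ℂ H).symm g, ext_inner_right ℂ fun f => ?_⟩
  have h5 : g (A f) = m (A f) := hg ⟨A f, f, rfl⟩
  rw [adjoint_inner_left, InnerProductSpace.toDual_symm_apply, h5, hm', adjoint_inner_right]

end Posinormal

/-! ### Matrices acting on the disk -/

/-- The matrix is invertible and its linear-fractional action maps the open unit disk into
itself. -/
structure MapsDisk (M : Matrix (Fin 2) (Fin 2) ℂ) : Prop where
  det_ne_zero : M.det ≠ 0
  norm_lt : ∀ x y : ℂ, ‖x‖ < ‖y‖ → ‖M 0 0 * x + M 0 1 * y‖ < ‖M 1 0 * x + M 1 1 * y‖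

namespace MapsDisk

variable {M N : Matrix (Fin 2) (Fin 2) ℂ}

theorem of_forall_norm_lt_one (hdet : M.det ≠ 0)
    (h : ∀ z : ℂ, ‖z‖ < 1 → ‖M 0 0 * z + M 0 1‖ < ‖M 1 0 * z + M 1 1‖) : MapsDisk M where
  det_ne_zero := hdet
  norm_lt x y hxy := by
    have hy : 0 < ‖y‖ := (norm_nonneg x).trans_lt hxy
    have hy0 : y ≠ 0 := norm_pos_iff.mp hy
    have h1 := h (x / y) (by rwa [norm_div, div_lt_one hy])
    have e : ∀ p q : ℂ, p * x + q * y = (p * (x / y) + q) * y := fun p q => by field_simp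
    rw [e, e, norm_mul, norm_mul]
    exact mul_lt_mul_of_pos_right h1 hy

theorem norm_lt_of_norm_lt_one (hM : MapsDisk M) {z : ℂ} (hz : ‖z‖ < 1) :
    ‖M 0 0 * z + M 0 1‖ < ‖M 1 0 * z + M 1 1‖ := by
  simpa using hM.norm_lt z 1 (by simpa using hz)

theorem mul (hM : MapsDisk M) (hN : MapsDisk N) : MapsDisk (M * N) where
  det_ne_zero := by
    rw [Matrix.det_mul]
    exact mul_ne_zero hM.det_ne_zero hN.det_ne_zero
  norm_lt x y hxy := by
    have h := hM.norm_lt _ _ (hN.norm_lt x y hxy)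
    simp only [Matrix.mul_apply, Fin.sum_univ_two]
    convert h using 1 <;> ring_nf

theorem smul (hM : MapsDisk M) {k : ℂ} (hk : k ≠ 0) : MapsDisk (k • M) where
  det_ne_zero := by
    rw [Matrix.det_smul]
    exact mul_ne_zero (pow_ne_zero _ hk) hM.det_ne_zero
  norm_lt x y hxy := by
    have h := mul_lt_mul_of_pos_left (hM.norm_lt x y hxy) (norm_pos_iff.mpr hk)
    rw [← norm_mul, ← norm_mul] at h
    simp only [Matrix.smul_apply, smul_eq_mul]
    simpa only [mul_add, mul_assoc] using h

theorem smul_iff {k : ℂ} (hk : k ≠ 0) : MapsDisk (k • M) ↔ MapsDisk M := by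
  refine ⟨fun h => ?_, fun h => h.smul hk⟩
  have := h.smul (inv_ne_zero hk)
  rwa [smul_smul, inv_mul_cancel₀ hk, one_smul] at this

theorem norm_le_of_norm_le_one (hM : MapsDisk M) {z : ℂ} (hz : ‖z‖ ≤ 1) :
    ‖M 0 0 * z + M 0 1‖ ≤ ‖M 1 0 * z + M 1 1‖ := by
  have h1 : z ∈ closure (Metric.ball (0 : ℂ) 1) := by
    rw [closure_ball _ one_ne_zero]
    simpa using hz
  have hcl : IsClosed {z : ℂ | ‖M 0 0 * z + M 0 1‖ ≤ ‖M 1 0 * z + M 1 1‖} :=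
    isClosed_le (by fun_prop) (by fun_prop)
  refine closure_minimal (fun y hy => ?_) hcl h1
  exact (hM.norm_lt_of_norm_lt_one (by simpa using hy)).le

/-- On the closed disk the numerator is dominated by the denominator, so at a pole both would
vanish, against invertibility of the matrix. Hence poles stay off the unit circle as well. -/
theorem denom_ne_zero (hM : MapsDisk M) {z : ℂ} (hz : ‖z‖ ≤ 1) : M 1 0 * z + M 1 1 ≠ 0 := by
  intro h0
  have h1 := hM.norm_le_of_norm_le_one hz
  rw [h0, norm_zero, norm_le_zero_iff] at h1
  refine hM.det_ne_zero ?_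
  rw [Matrix.det_fin_two]
  linear_combination M 0 0 * h0 - M 1 0 * h1

theorem norm_lt_of_forall_ne_zero {c d : ℂ} (h : ∀ z : ℂ, ‖z‖ ≤ 1 → c * z + d ≠ 0) :
    ‖c‖ < ‖d‖ := by
  by_contra! hcd
  rcases eq_or_ne c 0 with rfl | hc
  · have : d = 0 := by simpa using hcd
    exact h 0 (by simp) (by simp [this])
  · refine h (-d / c) ?_ (by field_simp; ring)
    rw [norm_div, norm_neg]
    exact div_le_one_of_le₀ hcd (norm_nonneg _)

theorem norm_10_lt_11 (hM : MapsDisk M) : ‖M 1 0‖ < ‖M 1 1‖ :=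
  norm_lt_of_forall_ne_zero fun _ hz => hM.denom_ne_zero hz

theorem norm_linearFractional_lt_one (hM : MapsDisk M) {z : ℂ} (hz : ‖z‖ < 1) :
    ‖linearFractional (M 0 0) (M 0 1) (M 1 0) (M 1 1) z‖ < 1 := by
  rw [linearFractional, norm_div, div_lt_one (norm_pos_iff.mpr (hM.denom_ne_zero hz.le))]
  exact hM.norm_lt_of_norm_lt_one hz

/-- The selfmap of the disk given by the linear-fractional action of a matrix. -/
noncomputable def toDisc (hM : MapsDisk M) (z : 𝔻) : 𝔻 :=
  .mk (linearFractional (M 0 0) (M 0 1) (M 1 0) (M 1 1) z)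
    (hM.norm_linearFractional_lt_one z.norm_lt_one)

theorem coe_toDisc_mul (hM : MapsDisk M) (z : 𝔻) :
    (hM.toDisc z : ℂ) * (M 1 0 * z + M 1 1) = M 0 0 * z + M 0 1 :=
  div_mul_cancel₀ _ (hM.denom_ne_zero z.norm_lt_one.le)

theorem coe_toDisc_eq_iff (hM : MapsDisk M) (z : 𝔻) (v : ℂ) :
    (hM.toDisc z : ℂ) = v ↔ M 0 0 * z + M 0 1 = v * (M 1 0 * z + M 1 1) :=
  div_eq_iff (hM.denom_ne_zero z.norm_lt_one.le)

theorem toDisc_mul (hM : MapsDisk M) (hN : MapsDisk N) (z : 𝔻) :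
    (hM.mul hN).toDisc z = hM.toDisc (hN.toDisc z) := by
  refine Complex.UnitDisc.coe_injective ?_
  rw [coe_toDisc_eq_iff]
  have h1 := hM.coe_toDisc_mul (hN.toDisc z)
  have h2 := hN.coe_toDisc_mul z
  simp only [Matrix.mul_apply, Fin.sum_univ_two]
  linear_combination (-(N 1 0 * z + N 1 1)) * h1 +
    ((hM.toDisc (hN.toDisc z) : ℂ) * M 1 0 - M 0 0) * h2

end MapsDisk

/-- The matrix of the disk involution that exchanges `0` and `w`. -/
def involutionMatrix (w : ℂ) : Matrix (Fin 2) (Fin 2) ℂ := !![-1, w; -conj w, 1]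

theorem involutionMatrix_mul_self (w : ℂ) :
    involutionMatrix w * involutionMatrix w = (1 - w * conj w) • 1 := by
  ext i j
  fin_cases i <;> fin_cases j <;> simp [involutionMatrix, Matrix.mul_apply, Fin.sum_univ_two] <;>
    ring

theorem one_sub_mul_conj_ne_zero {w : ℂ} (hw : ‖w‖ < 1) : 1 - w * conj w ≠ 0 := by
  rw [Complex.mul_conj, Complex.normSq_eq_norm_sq, sub_ne_zero]
  have : (1 : ℝ) ≠ ‖w‖ ^ 2 := by nlinarith [norm_nonneg w]
  exact_mod_cast this

theorem norm_mul_add_sq (p q z r : ℂ) : ‖p * z + q * r‖ ^ 2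
    = ‖p‖ ^ 2 * ‖z‖ ^ 2 + ‖q‖ ^ 2 * ‖r‖ ^ 2 + 2 * (p * z * conj (q * r)).re := by
  simp only [← Complex.normSq_eq_norm_sq]
  rw [Complex.normSq_add, Complex.normSq_mul, Complex.normSq_mul]

theorem mapsDisk_involutionMatrix {w : ℂ} (hw : ‖w‖ < 1) : MapsDisk (involutionMatrix w) where
  det_ne_zero := by
    have := one_sub_mul_conj_ne_zero hw
    rw [involutionMatrix, Matrix.det_fin_two_of]
    contrapose! this
    linear_combination -this
  norm_lt x y hxy := by
    have h1 := norm_mul_add_sq (-1) w x y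
    have h2 := norm_mul_add_sq (-conj w) 1 x y
    have h3 : (-conj w * x * conj (1 * y)).re = (-1 * x * conj (w * y)).re := by
      simp only [map_mul, map_one]; ring_nf
    rw [h3] at h2
    simp only [norm_neg, norm_one, RCLike.norm_conj] at h1 h2
    simp only [involutionMatrix, Matrix.of_apply, Matrix.cons_val', Matrix.cons_val_zero,
      Matrix.cons_val_one, Matrix.cons_val_fin_one]
    refine lt_of_pow_lt_pow_left₀ 2 (norm_nonneg _) ?_
    rw [h1, h2]
    have h4 : ‖w‖ ^ 2 < 1 := by nlinarith [norm_nonneg w]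
    have h5 : ‖x‖ ^ 2 < ‖y‖ ^ 2 := by nlinarith [norm_nonneg x]
    nlinarith

/-! ### Boundedness of the composition operators -/

namespace MapsDisk

open HardySpace

variable {M N : Matrix (Fin 2) (Fin 2) ℂ}

/-- Multiplication `T` by `φ` is a contraction, and its range is orthogonal to `k_w` because `φ(w) =
0`. So `∑ aₙ φⁿ k_w` converges in `H²` to `(f∘φ)·k_w`, boundedly in `f`. -/
theorem exists_compositionOperator_of_toDisc_eq_zero (hM : MapsDisk M) {w : 𝔻}
    (hw : hM.toDisc w = 0) :
    ∃ C : HardySpace →L[ℂ] HardySpace, ∀ (f : HardySpace) (z : 𝔻), C f z = f (hM.toDisc z) := by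
  set T := mulLinear (M 0 0) (M 0 1) ∘L divLinear (M 1 0) (M 1 1) with hTdef
  have hT : ∀ f, ‖T f‖ ≤ ‖f‖ := fun f =>
    (norm_mulLinear_le (fun z hz => hM.norm_le_of_norm_le_one hz.le) _).trans_eq
      (congrArg norm (mulLinear_divLinear hM.norm_10_lt_11 f))
  have hTz : ∀ f z, T f z = hM.toDisc z * f z := fun f z => by
    rw [hTdef, ContinuousLinearMap.comp_apply, mulLinear_apply, ← hM.coe_toDisc_mul, mul_assoc,
      divLinear_apply hM.norm_10_lt_11]
  have hk : ∀ f, inner ℂ (kernel w) (T f) = 0 := fun f => by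
    rw [inner_kernel, hTz, hw, Complex.UnitDisc.coe_zero, zero_mul]
  obtain ⟨L, hL⟩ := exists_clm_hasSum_smul_pow_apply hT hk
  have hpow : ∀ (n : ℕ) (z : 𝔻), (T ^ n) (kernel w) z = (hM.toDisc z : ℂ) ^ n * kernel w z := by
    intro n z
    induction n with
    | zero => simp
    | succ n ih =>
      rw [pow_succ', mul_apply_eq_comp, hTz, ih]
      ring
  -- Multiplication by `1 - w̄z` removes the factor `k_w`.
  refine ⟨mulLinear (-conj (w : ℂ)) 1 ∘L L ∘L coeffIsometry.toContinuousLinearEquiv, fun f z => ?_⟩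
  have h1 := hasSum_apply (hL (coeffEquiv f)) z
  simp only [HardySpace.smul_apply, hpow] at h1
  have h2 := ((hasSum_coeff f (hM.toDisc z)).mul_right (kernel w z))
  simp only [mul_assoc] at h2
  change mulLinear (-conj (w : ℂ)) 1 (L (coeffEquiv f)) z = _
  rw [mulLinear_apply, h1.unique h2]
  linear_combination f (hM.toDisc z) * kernel_mul_apply w z

/-- Let `τ` be the involution exchanging `0` and `w = φ(0)`. Both `τ` and `τ∘φ` vanish in the disk,
so the previous case covers them, and `φ = τ∘(τ∘φ)`. -/
theorem exists_compositionOperator (hM : MapsDisk M) :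
    ∃ C : HardySpace →L[ℂ] HardySpace, ∀ (f : HardySpace) (z : 𝔻), C f z = f (hM.toDisc z) := by
  set w := hM.toDisc 0 with hw
  have hN := mapsDisk_involutionMatrix w.norm_lt_one
  have hNw : hN.toDisc w = 0 := by
    refine Complex.UnitDisc.coe_injective ?_
    rw [coe_toDisc_eq_iff]
    simp [involutionMatrix]
  obtain ⟨C₁, hC₁⟩ := hN.exists_compositionOperator_of_toDisc_eq_zero hNw
  obtain ⟨C₂, hC₂⟩ := (hN.mul hM).exists_compositionOperator_of_toDisc_eq_zero (w := 0)
    (by rw [toDisc_mul hN hM, ← hw, hNw])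
  refine ⟨C₂ ∘L C₁, fun f z => ?_⟩
  rw [ContinuousLinearMap.comp_apply, hC₂, hC₁, ← toDisc_mul hN (hN.mul hM)]
  refine congrArg f ?_
  refine Complex.UnitDisc.coe_injective ?_
  rw [coe_toDisc_eq_iff, ← mul_assoc, involutionMatrix_mul_self]
  simp only [Matrix.smul_mul, one_mul, Matrix.smul_apply, smul_eq_mul]
  linear_combination (-(1 - (w : ℂ) * conj (w : ℂ))) * hM.coe_toDisc_mul z

theorem compositionOperator_apply (hM : MapsDisk M) (f : HardySpace) (z : 𝔻) :
    compositionOperator hM.toDisc f z = f (hM.toDisc z) := by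
  obtain ⟨C, hC⟩ := hM.exists_compositionOperator
  rw [compositionOperator_eq hC, hC]

theorem adjoint_compositionOperator_kernel (hM : MapsDisk M) (z : 𝔻) :
    ContinuousLinearMap.adjoint (compositionOperator hM.toDisc) (kernel z)
      = kernel (hM.toDisc z) := by
  refine ext_inner_right ℂ fun f => ?_
  rw [ContinuousLinearMap.adjoint_inner_left, inner_kernel, inner_kernel,
    hM.compositionOperator_apply]

end MapsDisk

/-! ### Absence of poles in the closed disk -/

namespace HardySpace

theorem exists_analyticOnNhd (v : HardySpace) :
    ∃ F : ℂ → ℂ, AnalyticOnNhd ℂ F (Metric.ball 0 1) ∧ ∀ z : 𝔻, F z = v z := by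
  set a := coeffEquiv v
  refine ⟨fun z => ∑' n, a n * z ^ n, ?_, fun z => (hasSum_coeff v z).tsum_eq⟩
  have hp : HasFPowerSeriesOnBall (fun z : ℂ => ∑' n, a n * z ^ n)
      (FormalMultilinearSeries.ofScalars ℂ fun n => a n) 0 1 := by
    refine ⟨?_, one_pos, fun {y} hy => ?_⟩
    · refine FormalMultilinearSeries.le_radius_of_bound (r := 1) _ ‖a‖ fun n => ?_
      rw [FormalMultilinearSeries.ofScalars_norm]
      simpa using lp.norm_apply_le_norm (by norm_num) a n
    · have hy' : ‖y‖ < 1 := by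
        rw [← ENNReal.ofReal_one, Metric.eball_ofReal] at hy
        simpa using hy
      have := (a.summable_powerSeries (.mk y hy')).hasSum
      simpa [FormalMultilinearSeries.ofScalars_apply_eq, mul_comm] using this
  have h := hp.analyticOnNhd
  rwa [← ENNReal.ofReal_one, Metric.eball_ofReal] at h

end HardySpace

namespace MapsDisk

open HardySpace Filter Topology

variable {M N : Matrix (Fin 2) (Fin 2) ℂ}

/-- The image contains a neighbourhood of the image of `0`, by the explicit inverse fraction. This
supplies the open set from which the identity theorem propagates. -/
theorem eventually_exists_toDisc_eq (hN : MapsDisk N) :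
    ∀ᶠ y in 𝓝 (hN.toDisc 0 : ℂ), ∃ z, (hN.toDisc z : ℂ) = y := by
  have h0 := hN.coe_toDisc_mul 0
  simp only [Complex.UnitDisc.coe_zero, mul_zero, zero_add] at h0
  set y₁ : ℂ := (hN.toDisc 0 : ℂ)
  have hdet := hN.det_ne_zero
  rw [Matrix.det_fin_two] at hdet
  have h11 : N 1 1 ≠ 0 := by
    have := hN.denom_ne_zero (z := 0) (by simp)
    simpa using this
  have hd : N 0 0 - N 1 0 * y₁ ≠ 0 := by
    contrapose! hdet
    linear_combination N 1 1 * hdet + N 1 0 * h0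
  have hc : ContinuousAt (fun y => (N 1 1 * y - N 0 1) / (N 0 0 - N 1 0 * y)) y₁ :=
    ContinuousAt.div (by fun_prop) (by fun_prop) hd
  have h1 : ∀ᶠ y in 𝓝 y₁, ‖(N 1 1 * y - N 0 1) / (N 0 0 - N 1 0 * y)‖ < 1 := by
    refine hc.norm.eventually_lt continuousAt_const ?_
    have : N 1 1 * y₁ - N 0 1 = 0 := by linear_combination h0
    simp [this]
  have h2 : ∀ᶠ y in 𝓝 y₁, N 0 0 - N 1 0 * y ≠ 0 :=
    ContinuousAt.eventually_ne (by fun_prop) hd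
  filter_upwards [h1, h2] with y hy1 hy2
  refine ⟨.mk _ hy1, ?_⟩
  rw [coe_toDisc_eq_iff, Complex.UnitDisc.coe_mk]
  refine mul_right_cancel₀ hy2 ?_
  linear_combination (N 0 0 - y * N 1 0) * div_mul_cancel₀ (N 1 1 * y - N 0 1) hy2

/-- If `v ∈ H²` equals `R / P` on an open set, then `R / P` has no poles in the closed disk. -/
theorem eq_zero_of_mul_eq (hN : MapsDisk N) (v : HardySpace) {P R : ℂ → ℂ}
    (hP : Differentiable ℂ P) (hR : Differentiable ℂ R)
    (h : ∀ z : 𝔻, v (hN.toDisc z) * P (hN.toDisc z) = R (hN.toDisc z)) {y : ℂ} (hy : ‖y‖ ≤ 1)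
    (hPy : P y = 0) : R y = 0 := by
  obtain ⟨F, hF, hFv⟩ := v.exists_analyticOnNhd
  have hPa : AnalyticOnNhd ℂ P (Metric.ball 0 1) :=
    hP.differentiableOn.analyticOnNhd Metric.isOpen_ball
  have hRa : AnalyticOnNhd ℂ R (Metric.ball 0 1) :=
    hR.differentiableOn.analyticOnNhd Metric.isOpen_ball
  have hev : F * P =ᶠ[𝓝 (hN.toDisc 0 : ℂ)] R := by
    filter_upwards [hN.eventually_exists_toDisc_eq] with y hy
    obtain ⟨z, rfl⟩ := hy
    rw [Pi.mul_apply, hFv, h]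
  have heq := (hF.mul hPa).eqOn_of_preconnected_of_eventuallyEq hRa
    (convex_ball (0 : ℂ) 1).isPreconnected
    (by simpa using (hN.toDisc 0).norm_lt_one) hev
  have hmul : ∀ z : 𝔻, v z * P z = R z := fun z => by
    have : F z * P z = R z := heq (by simpa using z.norm_lt_one)
    rwa [hFv] at this
  rcases hy.lt_or_eq with hy | hy
  · have := hmul (.mk y hy)
    rw [Complex.UnitDisc.coe_mk, hPy, mul_zero] at this
    exact this.symm
  -- On the circle, approach `y` radially. As `P(y) = 0`, `P(ry) = (r-1)·slope` with bounded slope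
  -- near `1`, and `|v(ry)|²(1-r²) ≤ ‖v‖²`. Hence `|R(ry)|²(1+r)` is `O(1-r)`, which forces `R(y) =
  -- 0`.
  set q : ℝ → ℂ := fun r => P (r * y) with hq
  have hqd : HasDerivAt q (y * deriv P (1 * y)) 1 := by
    have h1 : HasDerivAt (fun r : ℝ => (r : ℂ) * y) y 1 := by
      simpa using (Complex.ofRealCLM.hasDerivAt (x := 1)).mul_const y
    have h2 : HasDerivAt P (deriv P (1 * y)) (((1 : ℝ) : ℂ) * y) := by
      simpa using (hP (1 * y)).hasDerivAt
    exact h2.scomp (1 : ℝ) h1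
  have hslope := (hasDerivAt_iff_tendsto_slope.mp hqd).mono_left
    (nhdsWithin_mono 1 (fun r (hr : r < 1) => hr.ne) : 𝓝[<] (1 : ℝ) ≤ _)
  have hid : Tendsto (fun r : ℝ => r) (𝓝[<] 1) (𝓝 1) := tendsto_id.mono_left nhdsWithin_le_nhds
  have hRlim : Tendsto (fun r : ℝ => R (r * y)) (𝓝[<] 1) (𝓝 (R y)) := by
    have : Continuous fun r : ℝ => R (r * y) := hR.continuous.comp (by fun_prop)
    simpa using (this.tendsto 1).mono_left nhdsWithin_le_nhds
  have hl : Tendsto (fun r : ℝ => ‖R (r * y)‖ ^ 2 * (1 + r)) (𝓝[<] 1) (𝓝 (‖R y‖ ^ 2 * (1 + 1))) :=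
    (hRlim.norm.pow 2).mul (hid.const_add 1)
  have hr : Tendsto (fun r : ℝ => ‖v‖ ^ 2 * ‖slope q 1 r‖ ^ 2 * (1 - r)) (𝓝[<] 1)
      (𝓝 (‖v‖ ^ 2 * ‖y * deriv P (1 * y)‖ ^ 2 * (1 - 1))) :=
    ((hslope.norm.pow 2).const_mul _).mul (hid.const_sub 1)
  have hle : ∀ᶠ r : ℝ in 𝓝[<] 1,
      ‖R (r * y)‖ ^ 2 * (1 + r) ≤ ‖v‖ ^ 2 * ‖slope q 1 r‖ ^ 2 * (1 - r) := by
    filter_upwards [Ioo_mem_nhdsLT (zero_lt_one (α := ℝ))] with r hr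
    have hr1 : 0 < 1 - r := by linarith [hr.2]
    have hn : ‖(r : ℂ) * y‖ = r := by
      rw [norm_mul, hy, mul_one, Complex.norm_real, Real.norm_of_nonneg hr.1.le]
    obtain ⟨p, hp⟩ : ∃ p : 𝔻, (p : ℂ) = r * y := ⟨.mk (r * y) (by rw [hn]; exact hr.2), rfl⟩
    have h1 := hmul p
    have h2 := norm_apply_sq_mul_le v p
    rw [hp] at h1
    rw [hp, hn] at h2
    have h3 : P (r * y) = (r - 1 : ℝ) • slope q 1 r := by
      rw [sub_smul_slope, hq]
      simp [hPy]
    rw [← h1, h3, norm_mul, norm_smul, Real.norm_eq_abs, mul_pow, mul_pow, sq_abs]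
    nlinarith [mul_le_mul_of_nonneg_right h2 (mul_nonneg (sq_nonneg ‖slope q 1 r‖) hr1.le)]
  have := le_of_tendsto_of_tendsto hl hr hle
  rw [sub_self, mul_zero] at this
  have h4 : ‖R y‖ ^ 2 = 0 := le_antisymm (by linarith) (by positivity)
  simpa using h4

/-- If the map sent a point of the disk to modulus at least one or to infinity, the reciprocal of
the value would lie in the closed disk. By openness it can be moved to some `p` in the open disk
avoiding one prescribed value. That exception is needed because a single choice of kernel gives no
information. -/
theorem of_forall_ne (hdet : M.det ≠ 0) (p₀ : ℂ)
    (h : ∀ y p : ℂ, ‖y‖ < 1 → ‖p‖ < 1 → p ≠ p₀ → M 1 0 * y + M 1 1 ≠ p * (M 0 0 * y + M 0 1)) :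
    MapsDisk M := by
  refine of_forall_norm_lt_one hdet fun y hy => ?_
  by_contra! hle
  rw [Matrix.det_fin_two] at hdet
  set X := M 0 0 * y + M 0 1 with hX
  set Y := M 1 0 * y + M 1 1 with hY
  have hX0 : X ≠ 0 := by
    intro h0
    rw [h0, norm_zero, norm_le_zero_iff] at hle
    refine hdet ?_
    linear_combination M 0 0 * hle - M 1 0 * h0
  have hq : M 0 0 * (Y / X) - M 1 0 ≠ 0 := by
    intro h0
    field_simp at h0
    refine hdet ?_
    linear_combination h0
  have hG : (M 1 1 - M 0 1 * (Y / X)) / (M 0 0 * (Y / X) - M 1 0) = y := by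
    rw [div_eq_iff hq]
    field_simp
    rw [hX, hY]
    ring
  have h1 : ∀ᶠ q in 𝓝 (Y / X), ‖(M 1 1 - M 0 1 * q) / (M 0 0 * q - M 1 0)‖ < 1 := by
    have hc : ContinuousAt (fun q => (M 1 1 - M 0 1 * q) / (M 0 0 * q - M 1 0)) (Y / X) :=
      ContinuousAt.div (by fun_prop) (by fun_prop) hq
    refine hc.norm.eventually_lt continuousAt_const ?_
    rwa [hG]
  have h2 : ∀ᶠ q in 𝓝 (Y / X), M 0 0 * q - M 1 0 ≠ 0 :=
    ContinuousAt.eventually_ne (by fun_prop) hq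
  obtain ⟨U, hU, hUo, hmem⟩ := eventually_nhds_iff.mp (h1.and h2)
  have hcl : Y / X ∈ closure (Metric.ball (0 : ℂ) 1) := by
    rw [closure_ball _ one_ne_zero]
    simpa [norm_div] using div_le_one_of_le₀ hle (norm_nonneg _)
  obtain ⟨q, ⟨hqU, hqb⟩, hqp⟩ := (dense_compl_singleton p₀).inter_open_nonempty _
    (hUo.inter Metric.isOpen_ball) (mem_closure_iff.mp hcl U hUo hmem)
  obtain ⟨hq1, hq2⟩ := hU q hqU
  refine h _ q hq1 (by simpa using hqb) hqp (mul_right_cancel₀ hq2 ?_)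
  linear_combination (M 1 0 - q * M 0 0) * div_mul_cancel₀ (M 1 1 - M 0 1 * q) hq2

end MapsDisk

/-! ### Cowen's adjoint formula and the two quotient maps -/

open HardySpace ContinuousLinearMap

/-- The matrix of Cowen's adjoint map, the adjoint for the indefinite form `|x|² - |y|²`. -/
def sharp (M : Matrix (Fin 2) (Fin 2) ℂ) : Matrix (Fin 2) (Fin 2) ℂ :=
  !![conj (M 0 0), -conj (M 1 0); -conj (M 0 1), conj (M 1 1)]

theorem det_sharp (M : Matrix (Fin 2) (Fin 2) ℂ) : (sharp M).det = conj M.det := by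
  rw [sharp, Matrix.det_fin_two_of, Matrix.det_fin_two]
  simp only [map_sub, map_mul]
  ring

/-- The quotient `φ ∘ σ⁻¹` of a linear-fractional map and Cowen's adjoint map. -/
def mulSharpAdjugate (M : Matrix (Fin 2) (Fin 2) ℂ) : Matrix (Fin 2) (Fin 2) ℂ :=
  M * (sharp M).adjugate

/-- The quotient `σ ∘ φ⁻¹` of Cowen's adjoint map and a linear-fractional map. -/
def sharpMulAdjugate (M : Matrix (Fin 2) (Fin 2) ℂ) : Matrix (Fin 2) (Fin 2) ℂ :=
  sharp M * M.adjugate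

theorem mulSharpAdjugate_eq (M : Matrix (Fin 2) (Fin 2) ℂ) : mulSharpAdjugate M =
    !![M 0 0 * conj (M 1 1) + M 0 1 * conj (M 0 1), M 0 0 * conj (M 1 0) + M 0 1 * conj (M 0 0);
      M 1 0 * conj (M 1 1) + M 1 1 * conj (M 0 1),
      M 1 0 * conj (M 1 0) + M 1 1 * conj (M 0 0)] := by
  rw [mulSharpAdjugate, sharp, Matrix.adjugate_fin_two_of]
  ext i j
  fin_cases i <;> fin_cases j <;> simp [Matrix.mul_apply, Fin.sum_univ_two]

theorem sharpMulAdjugate_eq (M : Matrix (Fin 2) (Fin 2) ℂ) : sharpMulAdjugate M =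
    !![conj (M 0 0) * M 1 1 + conj (M 1 0) * M 1 0, -(conj (M 0 0) * M 0 1 + conj (M 1 0) * M 0 0);
      -(conj (M 0 1) * M 1 1 + conj (M 1 1) * M 1 0),
      conj (M 0 1) * M 0 1 + conj (M 1 1) * M 0 0] := by
  rw [sharpMulAdjugate, sharp, Matrix.adjugate_fin_two]
  ext i j
  fin_cases i <;> fin_cases j <;> simp [Matrix.mul_apply, Fin.sum_univ_two] <;> ring

namespace MapsDisk

variable {M N K : Matrix (Fin 2) (Fin 2) ℂ}

theorem toDisc_toDisc_eq (hM : MapsDisk M) (hN : MapsDisk N) (hK : MapsDisk K) {k : ℂ}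
    (h : M * N = k • K) (z : 𝔻) : hM.toDisc (hN.toDisc z) = hK.toDisc z := by
  rw [← toDisc_mul hM hN]
  refine Complex.UnitDisc.coe_injective ?_
  rw [coe_toDisc_eq_iff, h]
  simp only [Matrix.smul_apply, smul_eq_mul]
  linear_combination (-k) * hK.coe_toDisc_mul z

/-- `σ` is `φ⁻¹` conjugated by the reflection `z ↦ 1/z̄`. If `|σ(z)| ≥ 1` or `σ(z) = ∞`, then `φ`
would send `1/conj(σ(z)) = X/Y`, in the closed disk, to `1/z̄` (infinity when `z = 0`), outside it.
-/
protected theorem sharp (hM : MapsDisk M) : MapsDisk (sharp M) := by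
  have hdet : (sharp M).det ≠ 0 := by
    rw [det_sharp]
    simpa using hM.det_ne_zero
  refine of_forall_norm_lt_one hdet fun z hz => ?_
  have e1 : ‖sharp M 0 0 * z + sharp M 0 1‖ = ‖M 0 0 * conj z - M 1 0‖ := by
    rw [← RCLike.norm_conj]
    simp [sharp, sub_eq_add_neg]
  have e2 : ‖sharp M 1 0 * z + sharp M 1 1‖ = ‖M 1 1 - M 0 1 * conj z‖ := by
    rw [← RCLike.norm_conj]
    simp [sharp, sub_eq_neg_add]
  rw [e1, e2]
  by_contra! hle
  have hd := hM.det_ne_zero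
  rw [Matrix.det_fin_two] at hd
  set Y := M 0 0 * conj z - M 1 0 with hY
  set X := M 1 1 - M 0 1 * conj z with hX
  have hY0 : Y ≠ 0 := by
    intro h0
    rw [h0, norm_zero, norm_le_zero_iff] at hle
    refine hd ?_
    linear_combination M 0 0 * hle + M 0 1 * h0
  have h1 := hM.norm_le_of_norm_le_one (z := X / Y)
    (by rw [norm_div]; exact div_le_one_of_le₀ hle (norm_nonneg _))
  have e3 : M 0 0 * (X / Y) + M 0 1 = M.det / Y := by
    rw [Matrix.det_fin_two]; field_simp; rw [hX, hY]; ring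
  have e4 : M 1 0 * (X / Y) + M 1 1 = M.det / Y * conj z := by
    rw [Matrix.det_fin_two]; field_simp; rw [hX, hY]; ring
  rw [e3, e4, norm_mul, RCLike.norm_conj] at h1
  have h2 : 0 < ‖M.det / Y‖ := norm_pos_iff.mpr (div_ne_zero hM.det_ne_zero hY0)
  nlinarith

theorem coe_toDisc_sharp_mul (hM : MapsDisk M) (z : 𝔻) :
    (hM.sharp.toDisc z : ℂ) * (-conj (M 0 1) * z + conj (M 1 1))
      = conj (M 0 0) * z + -conj (M 1 0) :=
  hM.sharp.coe_toDisc_mul z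

/-- Cowen's formula for the adjoint of a linear-fractional composition operator. -/
theorem mul_adjoint_compositionOperator_apply (hM : MapsDisk M) (u : HardySpace) (z : 𝔻) :
    (-conj (M 0 1) * z + conj (M 1 1)) * adjoint (compositionOperator hM.toDisc) u z
      = adjoint (mulLinear (M 1 0) (M 1 1)) u (hM.sharp.toDisc z) := by
  have hden : ‖-conj (M 0 1)‖ < ‖conj (M 1 1)‖ := hM.sharp.norm_10_lt_11
  have key : adjoint (compositionOperator hM.toDisc) =
      divLinear (-conj (M 0 1)) (conj (M 1 1)) ∘L compositionOperator hM.sharp.toDisc ∘L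
        adjoint (mulLinear (M 1 0) (M 1 1)) := by
    refine clm_ext_kernel fun β => HardySpace.ext fun y => ?_
    have h0 : -conj (M 0 1) * (y : ℂ) + conj (M 1 1) ≠ 0 :=
      hM.sharp.denom_ne_zero y.norm_lt_one.le
    have h1 : adjoint (mulLinear (M 1 0) (M 1 1)) (kernel β)
        = conj (M 1 0 * β + M 1 1) • kernel β := by
      refine ext_inner_right ℂ fun f => ?_
      rw [adjoint_inner_left, inner_smul_left, inner_kernel, inner_kernel, mulLinear_apply,
        Complex.conj_conj]
    refine mul_left_cancel₀ h0 ?_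
    rw [comp_apply, divLinear_apply hden, comp_apply, hM.sharp.compositionOperator_apply, h1,
      HardySpace.smul_apply, hM.adjoint_compositionOperator_kernel]
    have h2 := kernel_mul_apply β (hM.sharp.toDisc y)
    have h3 := kernel_mul_apply (hM.toDisc β) y
    have h4 := congrArg conj (hM.coe_toDisc_mul β)
    have h5 := hM.coe_toDisc_sharp_mul y
    simp only [map_mul, map_add] at h4 ⊢
    set σ : ℂ := (hM.sharp.toDisc y : ℂ)
    set κ := kernel β (hM.sharp.toDisc y)
    set κ' := kernel (hM.toDisc β) y
    -- The identity behind Cowen's formula. Operators are compared on kernels, where `C_φ* k_β =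
    -- k_{φ(β)}` and `M_h* k_β = conj(h(β)) k_β`.
    have h6 : (conj (M 1 0) * conj (β : ℂ) + conj (M 1 1)) *
        (1 - conj (hM.toDisc β : ℂ) * y)
        = (-conj (M 0 1) * y + conj (M 1 1)) * (1 - conj (β : ℂ) * σ) := by
      linear_combination (-(y : ℂ)) * h4 + conj (β : ℂ) * h5
    linear_combination ((conj (M 1 0) * conj (β : ℂ) + conj (M 1 1)) * κ) * h3
      - (-conj (M 0 1) * y + conj (M 1 1)) * κ' * h2 - κ * κ' * h6
  rw [key, comp_apply, divLinear_apply hden, comp_apply, hM.sharp.compositionOperator_apply]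

theorem adjoint_mulLinear_adjoint_divLinear {c d : ℂ} (h : ‖c‖ < ‖d‖) (f : HardySpace) :
    adjoint (mulLinear c d) (adjoint (divLinear c d) f) = f := by
  rw [← comp_apply, ← adjoint_comp]
  have : divLinear c d ∘L mulLinear c d = ContinuousLinearMap.id ℂ HardySpace :=
    Ring.inverse_mul_cancel _ (isUnit_mulLinear h)
  rw [this, adjoint_id, id_apply]

/-- Solves `C_φ = C_φ* X` with `X = (M_h*)⁻¹ · conj(det M)/(b̄y+ā) · C_χ`. The strict inequality
makes `1/(b̄y+ā)` a bounded multiplier, and `χ∘σ = φ`. -/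
theorem isPosinormal_compositionOperator (hM : MapsDisk M) (h01 : ‖M 0 1‖ < ‖M 0 0‖)
    (hχ : MapsDisk (mulSharpAdjugate M)) : IsPosinormal (compositionOperator hM.toDisc) := by
  have h01' : ‖conj (M 0 1)‖ < ‖conj (M 0 0)‖ := by simpa using h01
  refine isPosinormal_of_eq_adjoint_comp (X := adjoint (divLinear (M 1 0) (M 1 1)) ∘L
    (conj M.det • divLinear (conj (M 0 1)) (conj (M 0 0))) ∘L compositionOperator hχ.toDisc) ?_
  ext f
  refine HardySpace.ext fun z => ?_
  have h0 : -conj (M 0 1) * (z : ℂ) + conj (M 1 1) ≠ 0 :=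
    hM.sharp.denom_ne_zero z.norm_lt_one.le
  refine mul_left_cancel₀ h0 ?_
  rw [comp_apply, hM.mul_adjoint_compositionOperator_apply, comp_apply,
    adjoint_mulLinear_adjoint_divLinear hM.norm_10_lt_11, comp_apply, hM.compositionOperator_apply]
  have h1 := divLinear_apply h01' (compositionOperator hχ.toDisc f) (hM.sharp.toDisc z)
  have hc : mulSharpAdjugate M * sharp M = conj M.det • M := by
    rw [mulSharpAdjugate, mul_assoc, Matrix.adjugate_mul, det_sharp, Matrix.mul_smul, mul_one]
  rw [hχ.compositionOperator_apply, toDisc_toDisc_eq hχ hM.sharp hM hc] at h1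
  have h5 := hM.coe_toDisc_sharp_mul z
  change _ = conj M.det *
    divLinear (conj (M 0 1)) (conj (M 0 0)) (compositionOperator hχ.toDisc f) (hM.sharp.toDisc z)
  set σ : ℂ := (hM.sharp.toDisc z : ℂ)
  set D := divLinear (conj (M 0 1)) (conj (M 0 0)) (compositionOperator hχ.toDisc f)
    (hM.sharp.toDisc z)
  -- What remains is `(b̄σ+ā)(-b̄z+d̄) = conj(det M)`.
  rw [← h1, Matrix.det_fin_two, map_sub, map_mul, map_mul]
  linear_combination (D * conj (M 0 1)) * h5

/-- Solves `C_φ* = C_φ X` using `ψ∘φ = σ`. The multiplier is the weight `1/(-b̄z+d̄)` rewritten as a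
function of `φ(z)`; its pole is that of `ψ`, so no condition like `|b| < |a|` appears. -/
theorem isCoposinormal_compositionOperator (hM : MapsDisk M)
    (hψ : MapsDisk (sharpMulAdjugate M)) : IsCoposinormal (compositionOperator hM.toDisc) := by
  set c := sharpMulAdjugate M 1 0 with hc
  set d := sharpMulAdjugate M 1 1 with hd
  have hcd : ‖c‖ < ‖d‖ := hψ.norm_10_lt_11
  refine isPosinormal_of_eq_adjoint_comp (X := divLinear c d ∘L mulLinear (-M 1 0) (M 0 0) ∘L
    compositionOperator hψ.toDisc ∘L adjoint (mulLinear (M 1 0) (M 1 1))) ?_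
  rw [adjoint_adjoint]
  ext u
  refine HardySpace.ext fun z => ?_
  have h0 : -conj (M 0 1) * (z : ℂ) + conj (M 1 1) ≠ 0 :=
    hM.sharp.denom_ne_zero z.norm_lt_one.le
  have h0' := hM.denom_ne_zero z.norm_lt_one.le
  rw [comp_apply, hM.compositionOperator_apply]
  have h1 := hM.mul_adjoint_compositionOperator_apply u z
  have h2 := divLinear_apply hcd (mulLinear (-M 1 0) (M 0 0) (compositionOperator hψ.toDisc
    (adjoint (mulLinear (M 1 0) (M 1 1)) u))) (hM.toDisc z)
  have hm : sharpMulAdjugate M * M = M.det • sharp M := by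
    rw [sharpMulAdjugate, mul_assoc, Matrix.adjugate_mul, Matrix.mul_smul, mul_one]
  rw [mulLinear_apply, hψ.compositionOperator_apply, toDisc_toDisc_eq hψ hM hM.sharp hm, ← h1]
    at h2
  have h3 := hM.coe_toDisc_mul z
  change _ = divLinear c d (mulLinear (-M 1 0) (M 0 0) (compositionOperator hψ.toDisc
    (adjoint (mulLinear (M 1 0) (M 1 1)) u))) (hM.toDisc z)
  set D := divLinear c d (mulLinear (-M 1 0) (M 0 0) (compositionOperator hψ.toDisc
    (adjoint (mulLinear (M 1 0) (M 1 1)) u))) (hM.toDisc z)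
  set A := adjoint (compositionOperator hM.toDisc) u z
  set φ : ℂ := (hM.toDisc z : ℂ)
  rw [hc, hd, sharpMulAdjugate_eq] at h2
  simp only [Matrix.of_apply, Matrix.cons_val', Matrix.cons_val_zero,
    Matrix.cons_val_one, Matrix.cons_val_fin_one] at h2
  have hdet := hM.det_ne_zero
  have e1 : (-M 1 0 * φ + M 0 0) * (M 1 0 * z + M 1 1) = M.det := by
    rw [Matrix.det_fin_two]
    linear_combination (-M 1 0) * h3
  have e2 : (-(conj (M 0 1) * M 1 1 + conj (M 1 1) * M 1 0) * φ +
      (conj (M 0 1) * M 0 1 + conj (M 1 1) * M 0 0)) * (M 1 0 * z + M 1 1)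
      = M.det * (-conj (M 0 1) * z + conj (M 1 1)) := by
    rw [Matrix.det_fin_two]
    linear_combination (-(conj (M 0 1) * M 1 1 + conj (M 1 1) * M 1 0)) * h3
  refine mul_left_cancel₀ (mul_ne_zero hdet h0) ?_
  linear_combination (-(-conj (M 0 1) * z + conj (M 1 1)) * A) * e1 + D * e2
    - (M 1 0 * z + M 1 1) * h2

theorem det_mulSharpAdjugate_ne_zero (h : M.det ≠ 0) : (mulSharpAdjugate M).det ≠ 0 := by
  rw [mulSharpAdjugate, Matrix.det_mul, Matrix.det_adjugate, det_sharp]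
  simpa using h

theorem det_sharpMulAdjugate_ne_zero (h : M.det ≠ 0) : (sharpMulAdjugate M).det ≠ 0 := by
  rw [sharpMulAdjugate, Matrix.det_mul, Matrix.det_adjugate, det_sharp]
  simpa using h

end MapsDisk

/-! ### Matrix criteria for posinormality and coposinormality -/

namespace MapsDisk

open HardySpace ContinuousLinearMap

variable {M : Matrix (Fin 2) (Fin 2) ℂ}

theorem exists_apply_sharp_toDisc_eq (hM : MapsDisk M)
    (hC : IsPosinormal (compositionOperator hM.toDisc)) (f : HardySpace) :
    ∃ v : HardySpace, ∀ z : 𝔻, v (hM.sharp.toDisc z)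
      = (-conj (M 0 1) * z + conj (M 1 1)) * f (hM.toDisc z) := by
  obtain ⟨u, hu⟩ := hC.exists_adjoint_apply_eq f
  refine ⟨adjoint (mulLinear (M 1 0) (M 1 1)) u, fun z => ?_⟩
  rw [← hM.mul_adjoint_compositionOperator_apply, hu, hM.compositionOperator_apply]

/-- With `f = 1` the function `v` is `conj(det M)/(b̄y+ā)`, so `b̄y+ā` has no zero in the closed
disk. -/
theorem norm_01_lt_00_of_isPosinormal (hM : MapsDisk M)
    (hC : IsPosinormal (compositionOperator hM.toDisc)) : ‖M 0 1‖ < ‖M 0 0‖ := by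
  obtain ⟨v, hv⟩ := hM.exists_apply_sharp_toDisc_eq hC (kernel 0)
  have hdet : conj M.det ≠ 0 := by simpa using hM.det_ne_zero
  have h := norm_lt_of_forall_ne_zero (c := conj (M 0 1)) (d := conj (M 0 0)) fun y hy h0 =>
    hdet (hM.sharp.eq_zero_of_mul_eq v (P := fun y => conj (M 0 1) * y + conj (M 0 0))
      (R := fun _ => conj M.det) (by fun_prop) (by fun_prop) (fun z => by
        rw [hv, kernel_zero_apply, Matrix.det_fin_two, map_sub, map_mul, map_mul]
        linear_combination conj (M 0 1) * hM.coe_toDisc_sharp_mul z) hy h0)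
  simpa using h

theorem mapsDisk_mulSharpAdjugate_of_isPosinormal (hM : MapsDisk M)
    (hC : IsPosinormal (compositionOperator hM.toDisc)) : MapsDisk (mulSharpAdjugate M) := by
  have hX := det_mulSharpAdjugate_ne_zero hM.det_ne_zero
  -- The value `p = 0` is skipped: its kernel is the constant `1`, which does not see `χ`. For other
  -- `p`, a solution of `χ(y) = 1/p` in the disk would be a pole of `k_β∘χ`, with `β = p̄`.
  refine of_forall_ne hX 0 fun y p hy hp hp0 hyp => ?_
  obtain ⟨β, hβ⟩ : ∃ β : 𝔻, (β : ℂ) = conj p := ⟨.mk (conj p) (by simpa using hp), rfl⟩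
  obtain ⟨v, hv⟩ := hM.exists_apply_sharp_toDisc_eq hC (kernel β)
  have hdet : conj M.det ≠ 0 := by simpa using hM.det_ne_zero
  set X := mulSharpAdjugate M with hXdef
  have hker : ∀ z : 𝔻, (1 - p * z) * kernel β z = 1 := fun z => by
    have := kernel_mul_apply β z
    rwa [hβ, Complex.conj_conj] at this
  have hR := hM.sharp.eq_zero_of_mul_eq v
    (P := fun y => (conj (M 0 1) * y + conj (M 0 0)) *
      ((X 1 0 * y + X 1 1) - p * (X 0 0 * y + X 0 1)))
    (R := fun y => conj M.det * (X 1 0 * y + X 1 1)) (by fun_prop) (by fun_prop) (fun z => by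
      have h0 := hM.sharp.denom_ne_zero z.norm_lt_one.le
      change -conj (M 0 1) * (z : ℂ) + conj (M 1 1) ≠ 0 at h0
      have h1 := hM.coe_toDisc_sharp_mul z
      have h2 := hM.coe_toDisc_mul z
      have h3 := hker (hM.toDisc z)
      rw [hv]
      set κ := kernel β (hM.toDisc z)
      set φ : ℂ := (hM.toDisc z : ℂ)
      set σ : ℂ := (hM.sharp.toDisc z : ℂ)
      have h4 : (conj (M 0 1) * σ + conj (M 0 0)) * (-conj (M 0 1) * (z : ℂ) + conj (M 1 1))
          = conj M.det := by
        rw [Matrix.det_fin_two, map_sub, map_mul, map_mul]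
        linear_combination conj (M 0 1) * h1
      have h5 : X 0 0 * σ + X 0 1 = φ * (X 1 0 * σ + X 1 1) := by
        refine mul_right_cancel₀ h0 ?_
        rw [hXdef, mulSharpAdjugate_eq]
        simp only [Matrix.of_apply, Matrix.cons_val', Matrix.cons_val_zero,
          Matrix.cons_val_one, Matrix.cons_val_fin_one]
        linear_combination (M 0 0 * conj (M 1 1) + M 0 1 * conj (M 0 1)
          - φ * (M 1 0 * conj (M 1 1) + M 1 1 * conj (M 0 1))) * h1
          - (conj (M 0 0) * conj (M 1 1) - conj (M 0 1) * conj (M 1 0)) * h2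
      linear_combination (κ * ((X 1 0 * σ + X 1 1) - p * (X 0 0 * σ + X 0 1))) * h4
        - conj M.det * κ * p * h5 + conj M.det * (X 1 0 * σ + X 1 1) * h3) hy.le
    (by simp only [hyp, sub_self, mul_zero])
  have h1 : X 1 0 * y + X 1 1 = 0 := (mul_eq_zero.mp hR).resolve_left hdet
  rw [h1, eq_comm] at hyp
  have h2 := (mul_eq_zero.mp hyp).resolve_left hp0
  refine hX ?_
  rw [Matrix.det_fin_two]
  linear_combination X 0 0 * h1 - X 1 0 * h2

theorem mapsDisk_sharpMulAdjugate_of_isCoposinormal (hM : MapsDisk M)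
    (hC : IsCoposinormal (compositionOperator hM.toDisc)) : MapsDisk (sharpMulAdjugate M) := by
  have hdet := hM.det_ne_zero
  rw [Matrix.det_fin_two] at hdet
  -- The skipped value is the conjugate of the zero of `φ`: there `φ(β) = 0` and `k_{φ(β)}` is
  -- constant.
  refine of_forall_ne (det_sharpMulAdjugate_ne_zero hM.det_ne_zero)
    (-conj (M 0 1) / conj (M 0 0)) fun y p hy hp hp0 hyp => ?_
  obtain ⟨β, hβ⟩ : ∃ β : 𝔻, (β : ℂ) = conj p := ⟨.mk (conj p) (by simpa using hp), rfl⟩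
  obtain ⟨v, hv⟩ := hC.exists_adjoint_apply_eq (kernel β)
  rw [adjoint_adjoint, hM.adjoint_compositionOperator_kernel] at hv
  have hv' : ∀ z, v (hM.toDisc z) = kernel (hM.toDisc β) z := fun z => by
    rw [← hM.compositionOperator_apply, hv]
  have hq := congrArg conj (hM.coe_toDisc_mul β)
  have hq0 := (map_ne_zero (starRingEnd ℂ)).mpr (hM.denom_ne_zero β.norm_lt_one.le)
  simp only [map_mul, map_add, hβ, Complex.conj_conj] at hq hq0
  set q := conj (hM.toDisc β : ℂ) with hqdef
  rw [sharpMulAdjugate_eq] at hyp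
  simp only [Matrix.of_apply, Matrix.cons_val', Matrix.cons_val_zero,
    Matrix.cons_val_one, Matrix.cons_val_fin_one] at hyp
  have hP : (M 0 0 - M 1 0 * y) - q * (M 1 1 * y - M 0 1) = 0 := by
    refine (mul_eq_zero.mp ?_).resolve_right hq0
    linear_combination hyp - (M 1 1 * y - M 0 1) * hq
  -- Here `v(y) = 1/(1 - q φ⁻¹(y))`, cleared of fractions by `φ⁻¹(y) = (dy-b)/(a-cy)`.
  have hR : M 0 0 - M 1 0 * y = 0 :=
    hM.eq_zero_of_mul_eq v (P := fun y => (M 0 0 - M 1 0 * y) - q * (M 1 1 * y - M 0 1))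
      (R := fun y => M 0 0 - M 1 0 * y) (by fun_prop) (by fun_prop) (fun z => by
        have h0 := hM.denom_ne_zero z.norm_lt_one.le
        have h1 := hM.coe_toDisc_mul z
        have h2 := kernel_mul_apply (hM.toDisc β) z
        rw [← hqdef] at h2
        rw [hv']
        refine mul_right_cancel₀ h0 ?_
        linear_combination (-(kernel (hM.toDisc β) z) * (M 1 0 + q * M 1 1) + M 1 0) * h1
          + (M 0 0 * M 1 1 - M 0 1 * M 1 0) * h2) hy.le hP
  rw [hR, zero_sub, neg_eq_zero] at hP
  have h3 : M 1 1 * y - M 0 1 ≠ 0 := by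
    intro h0
    refine hdet ?_
    linear_combination M 1 1 * hR + M 1 0 * h0
  rw [(mul_eq_zero.mp hP).resolve_right h3, zero_mul] at hq
  -- When `a = 0` the skipped value is the default `0` of division and means nothing; but then `q =
  -- 0` forces `b = 0`, against `det M ≠ 0`.
  rcases eq_or_ne (M 0 0) 0 with ha | ha
  · rw [ha] at hq
    simp only [map_zero, zero_mul, zero_add] at hq
    rw [eq_comm, map_eq_zero] at hq
    refine hdet ?_
    rw [ha, hq]
    ring
  · refine hp0 ?_
    rw [eq_div_iff ((map_ne_zero _).mpr ha)]
    linear_combination -hq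

theorem isPosinormal_compositionOperator_iff (hM : MapsDisk M) :
    IsPosinormal (compositionOperator hM.toDisc) ↔
      ‖M 0 1‖ < ‖M 0 0‖ ∧ MapsDisk (mulSharpAdjugate M) :=
  ⟨fun h => ⟨hM.norm_01_lt_00_of_isPosinormal h, hM.mapsDisk_mulSharpAdjugate_of_isPosinormal h⟩,
    fun h => hM.isPosinormal_compositionOperator h.1 h.2⟩

theorem isCoposinormal_compositionOperator_iff (hM : MapsDisk M) :
    IsCoposinormal (compositionOperator hM.toDisc) ↔ MapsDisk (sharpMulAdjugate M) :=
  ⟨hM.mapsDisk_sharpMulAdjugate_of_isCoposinormal, hM.isCoposinormal_compositionOperator⟩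

/-- The adjugate represents `φ⁻¹`, so `C_φ` is invertible and both range inclusions are trivial. -/
theorem isPosinormal_and_isCoposinormal_of_adjugate (hM : MapsDisk M) (hA : MapsDisk M.adjugate) :
    IsPosinormal (compositionOperator hM.toDisc) ∧
      IsCoposinormal (compositionOperator hM.toDisc) := by
  have h1 : ∀ z : 𝔻, hM.toDisc (hA.toDisc z) = z := fun z => by
    rw [← toDisc_mul hM hA]
    refine Complex.UnitDisc.coe_injective ?_
    rw [coe_toDisc_eq_iff, Matrix.mul_adjugate]
    simp
    ring
  have h2 : ∀ z : 𝔻, hA.toDisc (hM.toDisc z) = z := fun z => by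
    rw [← toDisc_mul hA hM]
    refine Complex.UnitDisc.coe_injective ?_
    rw [coe_toDisc_eq_iff, Matrix.adjugate_mul]
    simp
    ring
  refine isPosinormal_of_leftInverse_of_rightInverse (B := compositionOperator hA.toDisc)
    (fun f => HardySpace.ext fun z => ?_) fun f => HardySpace.ext fun z => ?_
  · rw [hM.compositionOperator_apply, hA.compositionOperator_apply, h2]
  · rw [hA.compositionOperator_apply, hM.compositionOperator_apply, h1]

end MapsDisk

/-! ### Behaviour of the quotient maps under conjugation and scaling -/

theorem sharp_mul (M N : Matrix (Fin 2) (Fin 2) ℂ) : sharp (M * N) = sharp N * sharp M := by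
  ext i j
  fin_cases i <;> fin_cases j <;> simp [sharp, Matrix.mul_apply, Fin.sum_univ_two] <;> ring

theorem sharp_involutionMatrix (w : ℂ) : sharp (involutionMatrix w) = involutionMatrix w := by
  ext i j
  fin_cases i <;> fin_cases j <;> simp [sharp, involutionMatrix]

theorem adjugate_involutionMatrix (w : ℂ) :
    (involutionMatrix w).adjugate = -involutionMatrix w := by
  rw [involutionMatrix, Matrix.adjugate_fin_two_of]
  ext i j
  fin_cases i <;> fin_cases j <;> simp

theorem involutionMatrix_mul_mul_mul_self (w : ℂ) (M : Matrix (Fin 2) (Fin 2) ℂ) :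
    involutionMatrix w * (involutionMatrix w * M * involutionMatrix w) * involutionMatrix w
      = ((1 - w * conj w) * (1 - w * conj w)) • M := by
  have h := involutionMatrix_mul_self w
  calc _ = (involutionMatrix w * involutionMatrix w) * M *
        (involutionMatrix w * involutionMatrix w) := by simp only [mul_assoc]
    _ = _ := by rw [h]; simp [smul_smul]

/-- `sharp` and the adjugate both reverse products, the involution matrix is fixed by `sharp` and
negated by the adjugate, and the inner pair of involutions collapses to a scalar. So the quotient is
conjugated along with `M`. -/
theorem mulSharpAdjugate_involution_conj (w : ℂ) (M : Matrix (Fin 2) (Fin 2) ℂ) :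
    mulSharpAdjugate (involutionMatrix w * M * involutionMatrix w)
      = (1 - w * conj w) • (involutionMatrix w * mulSharpAdjugate M * involutionMatrix w) := by
  have h := involutionMatrix_mul_self w
  rw [mulSharpAdjugate, mulSharpAdjugate, sharp_mul, sharp_mul, sharp_involutionMatrix,
    Matrix.adjugate_mul_distrib, Matrix.adjugate_mul_distrib, adjugate_involutionMatrix]
  calc _ = involutionMatrix w * M * (involutionMatrix w * involutionMatrix w) *
        ((sharp M).adjugate * involutionMatrix w) := by simp only [mul_assoc, neg_mul, mul_neg,
          neg_neg]
    _ = _ := by rw [h]; simp [mul_assoc]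

theorem sharpMulAdjugate_involution_conj (w : ℂ) (M : Matrix (Fin 2) (Fin 2) ℂ) :
    sharpMulAdjugate (involutionMatrix w * M * involutionMatrix w)
      = (1 - w * conj w) • (involutionMatrix w * sharpMulAdjugate M * involutionMatrix w) := by
  have h := involutionMatrix_mul_self w
  rw [sharpMulAdjugate, sharpMulAdjugate, sharp_mul, sharp_mul, sharp_involutionMatrix,
    Matrix.adjugate_mul_distrib, Matrix.adjugate_mul_distrib, adjugate_involutionMatrix]
  calc _ = involutionMatrix w * sharp M * (involutionMatrix w * involutionMatrix w) *
        (M.adjugate * involutionMatrix w) := by simp only [mul_assoc, neg_mul, mul_neg, neg_neg]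
    _ = _ := by rw [h]; simp [mul_assoc]

theorem mulSharpAdjugate_smul (k : ℂ) (M : Matrix (Fin 2) (Fin 2) ℂ) :
    mulSharpAdjugate (k • M) = (k * conj k) • mulSharpAdjugate M := by
  rw [mulSharpAdjugate_eq, mulSharpAdjugate_eq]
  ext i j
  fin_cases i <;> fin_cases j <;> simp <;> ring

theorem sharpMulAdjugate_smul (k : ℂ) (M : Matrix (Fin 2) (Fin 2) ℂ) :
    sharpMulAdjugate (k • M) = (k * conj k) • sharpMulAdjugate M := by
  rw [sharpMulAdjugate_eq, sharpMulAdjugate_eq]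
  ext i j
  fin_cases i <;> fin_cases j <;> simp <;> ring

namespace MapsDisk

variable {M L : Matrix (Fin 2) (Fin 2) ℂ}

theorem involution_conj_iff {w : ℂ} (hw : ‖w‖ < 1) :
    MapsDisk (involutionMatrix w * M * involutionMatrix w) ↔ MapsDisk M := by
  have hN := mapsDisk_involutionMatrix hw
  have h0 := one_sub_mul_conj_ne_zero hw
  refine ⟨fun h => ?_, fun h => (hN.mul h).mul hN⟩
  have := (hN.mul h).mul hN
  rwa [involutionMatrix_mul_mul_mul_self, smul_iff (mul_ne_zero h0 h0)] at this

theorem mul_involution_iff {w : ℂ} (hw : ‖w‖ < 1) :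
    MapsDisk (M * involutionMatrix w) ↔ MapsDisk M := by
  have hN := mapsDisk_involutionMatrix hw
  refine ⟨fun h => ?_, fun h => h.mul hN⟩
  have := h.mul hN
  rwa [mul_assoc, involutionMatrix_mul_self, Matrix.mul_smul, mul_one,
    smul_iff (one_sub_mul_conj_ne_zero hw)] at this

theorem mulSharpAdjugate_iff_of_conj {w k : ℂ} (hw : ‖w‖ < 1) (hk : k ≠ 0)
    (h : involutionMatrix w * M * involutionMatrix w = k • L) :
    MapsDisk (mulSharpAdjugate M) ↔ MapsDisk (mulSharpAdjugate L) := by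
  rw [← involution_conj_iff hw, ← smul_iff (one_sub_mul_conj_ne_zero hw),
    ← mulSharpAdjugate_involution_conj, h, mulSharpAdjugate_smul,
    smul_iff (mul_ne_zero hk ((map_ne_zero _).mpr hk))]

theorem sharpMulAdjugate_iff_of_conj {w k : ℂ} (hw : ‖w‖ < 1) (hk : k ≠ 0)
    (h : involutionMatrix w * M * involutionMatrix w = k • L) :
    MapsDisk (sharpMulAdjugate M) ↔ MapsDisk (sharpMulAdjugate L) := by
  rw [← involution_conj_iff hw, ← smul_iff (one_sub_mul_conj_ne_zero hw),
    ← sharpMulAdjugate_involution_conj, h, sharpMulAdjugate_smul,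
    smul_iff (mul_ne_zero hk ((map_ne_zero _).mpr hk))]

end MapsDisk

/-! ### Normal form for an interior fixed point -/

theorem mapsDisk_lowerTriangular_iff {α γ δ : ℂ} :
    MapsDisk !![α, 0; γ, δ] ↔ α ≠ 0 ∧ δ ≠ 0 ∧ ‖α‖ + ‖γ‖ ≤ ‖δ‖ := by
  constructor
  · intro h
    have hdet := h.det_ne_zero
    rw [Matrix.det_fin_two_of, zero_mul, sub_zero] at hdet
    have hα := left_ne_zero_of_mul hdet
    have hδ := right_ne_zero_of_mul hdet
    have hlt : ‖γ‖ < ‖δ‖ := h.norm_10_lt_11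
    have hδ' : (‖δ‖ : ℂ) ≠ 0 := by exact_mod_cast norm_ne_zero_iff.mpr hδ
    refine ⟨hα, hδ, ?_⟩
    -- The point of the circle where `γz` is opposite to `δ`, so that `|γz+δ|` takes its least value
    -- `|δ|-|γ|`.
    obtain ⟨z, hz, hγz⟩ : ∃ z : ℂ, ‖z‖ = 1 ∧ γ * z = -(‖γ‖ / ‖δ‖ : ℝ) * δ := by
      rcases eq_or_ne γ 0 with rfl | hγ
      · exact ⟨1, by simp, by simp⟩
      · refine ⟨-(‖γ‖ * δ) / (‖δ‖ * γ), ?_, ?_⟩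
        · have h1 := norm_ne_zero_iff.mpr hδ
          have h2 := norm_ne_zero_iff.mpr hγ
          simp only [norm_div, norm_neg, norm_mul, Complex.norm_real, norm_norm]
          field_simp
        · push_cast
          field_simp
    have h1 : ‖α * z + 0‖ ≤ ‖γ * z + δ‖ := h.norm_le_of_norm_le_one hz.le
    have h2 : γ * z + δ = (1 - ‖γ‖ / ‖δ‖ : ℝ) * δ := by
      rw [hγz]; push_cast; ring
    have hpos : 0 < ‖δ‖ := norm_pos_iff.mpr hδ
    have h3 : 0 ≤ 1 - ‖γ‖ / ‖δ‖ := by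
      rw [sub_nonneg, div_le_one hpos]
      exact hlt.le
    rw [h2, add_zero, norm_mul, hz, norm_mul, Complex.norm_real, Real.norm_of_nonneg h3, sub_mul,
      div_mul_cancel₀ _ hpos.ne'] at h1
    linarith
  · rintro ⟨hα, hδ, hle⟩
    refine MapsDisk.of_forall_norm_lt_one ?_ fun z hz => ?_
    · rw [Matrix.det_fin_two_of, zero_mul, sub_zero]
      exact mul_ne_zero hα hδ
    · change ‖α * z + 0‖ < ‖γ * z + δ‖
      have h1 : ‖δ‖ - ‖γ‖ * ‖z‖ ≤ ‖γ * z + δ‖ := by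
        have := norm_sub_norm_le δ (-(γ * z))
        rwa [norm_neg, norm_mul, sub_neg_eq_add, add_comm δ] at this
      rw [add_zero, norm_mul]
      have h2 : 0 < ‖α‖ := norm_pos_iff.mpr hα
      nlinarith [norm_nonneg γ, mul_pos h2 (sub_pos.mpr hz),
        mul_nonneg (norm_nonneg γ) (sub_nonneg.mpr hz.le)]

theorem mul_conj_eq_norm_sq (c : ℂ) : c * conj c = (‖c‖ ^ 2 : ℝ) := by
  rw [Complex.mul_conj, Complex.normSq_eq_norm_sq]

theorem mapsDisk_mulSharpAdjugate_lowerTriangular_iff {a c : ℂ} (hL : MapsDisk !![a, 0; c, 1]) :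
    MapsDisk (mulSharpAdjugate !![a, 0; c, 1]) ↔ c = 0 ∨ ‖1 - a‖ = ‖c‖ := by
  obtain ⟨ha, -, hle⟩ := mapsDisk_lowerTriangular_iff.mp hL
  rw [norm_one] at hle
  have hr : 0 < ‖a‖ := norm_pos_iff.mpr ha
  have hs := norm_nonneg c
  have hs1 : ‖c‖ < 1 := by linarith
  have hcc := mul_conj_eq_norm_sq c
  -- `χ` vanishes at `-c̄`; precomposing with the involution that exchanges `0` and `-c̄` gives a
  -- map fixing `0`, to which the triangular criterion applies.
  have e : mulSharpAdjugate !![a, 0; c, 1] * involutionMatrix (-conj c)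
      = !![-((1 - ‖c‖ ^ 2 : ℝ) * a), 0; -(c * conj ((1 - ‖c‖ ^ 2 : ℝ) - a)), conj a] := by
    rw [mulSharpAdjugate_eq]
    push_cast at hcc ⊢
    ext i j
    fin_cases i <;> fin_cases j <;>
      simp [involutionMatrix, Matrix.mul_apply, Fin.sum_univ_two]
    · linear_combination a * hcc
    · linear_combination c * hcc
  have hs2 : 0 < 1 - ‖c‖ ^ 2 := by nlinarith
  rw [← MapsDisk.mul_involution_iff (w := -conj c) (by simpa using hs1), e,
    mapsDisk_lowerTriangular_iff, norm_neg, norm_neg, norm_mul, norm_mul, RCLike.norm_conj,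
    RCLike.norm_conj, Complex.norm_real, Real.norm_of_nonneg hs2.le]
  have hne : -(((1 - ‖c‖ ^ 2 : ℝ) : ℂ) * a) ≠ 0 :=
    neg_ne_zero.mpr (mul_ne_zero (Complex.ofReal_ne_zero.mpr hs2.ne') ha)
  have habs := norm_sub_norm_le ((1 - ‖c‖ ^ 2 : ℝ) : ℂ) a
  rw [Complex.norm_real, Real.norm_of_nonneg hs2.le] at habs
  have hsq : ∀ t : ℝ, ‖(t : ℂ) - a‖ ^ 2 = t ^ 2 - 2 * t * a.re + ‖a‖ ^ 2 := fun t => by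
    rw [← Complex.normSq_eq_norm_sq, ← Complex.normSq_eq_norm_sq, Complex.normSq_apply,
      Complex.normSq_apply]
    simp
    ring
  have hsq1 := hsq 1
  rw [Complex.ofReal_one] at hsq1
  have hsq2 := hsq (1 - ‖c‖ ^ 2)
  constructor
  · rintro ⟨-, -, h⟩
    rcases eq_or_ne c 0 with hc | hc
    · exact Or.inl hc
    · right
      have hc' : 0 < ‖c‖ := norm_pos_iff.mpr hc
      have h1 : ‖((1 - ‖c‖ ^ 2 : ℝ) : ℂ) - a‖ ≤ ‖a‖ * ‖c‖ := by
        refine le_of_mul_le_mul_left ?_ hc'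
        nlinarith
      -- The reverse triangle inequality gives `1-|c|² ≤ |a|(1+|c|)`, so `|a|+|c| ≥ 1`; the opposite
      -- inequality is the selfmap condition. Equality then holds throughout, which makes `a` a
      -- positive real.
      have h2 : ‖c‖ = 1 - ‖a‖ := by
        have : 0 ≤ (‖c‖ + ‖a‖ - 1) * (1 + ‖c‖) := by nlinarith
        nlinarith [nonneg_of_mul_nonneg_left this (by linarith)]
      have h3 : ‖((1 - ‖c‖ ^ 2 : ℝ) : ℂ) - a‖ = ‖a‖ * ‖c‖ := by
        refine le_antisymm h1 (le_trans (le_of_eq ?_) habs)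
        rw [h2]; ring
      have h4 : a.re = ‖a‖ := by
        rw [h3] at hsq2
        have : (1 - ‖c‖ ^ 2) * (a.re - ‖a‖) = 0 := by
          have h5 : ‖a‖ = 1 - ‖c‖ := by linarith
          rw [h5] at hsq2 ⊢
          nlinarith
        have := (mul_eq_zero.mp this).resolve_left hs2.ne'
        linarith
      refine (sq_eq_sq₀ (norm_nonneg _) hs).mp ?_
      rw [hsq1, h4, h2]
      ring
  · intro h
    refine ⟨hne, (map_ne_zero _).mpr ha, ?_⟩
    rcases h with rfl | h
    · simp
    · have h1 := norm_sub_norm_le 1 a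
      rw [norm_one, h] at h1
      have h2 : ‖c‖ = 1 - ‖a‖ := by linarith
      have h4 : a.re = ‖a‖ := by
        rw [h, h2] at hsq1
        nlinarith
      have h3 : ‖((1 - ‖c‖ ^ 2 : ℝ) : ℂ) - a‖ = ‖a‖ * ‖c‖ := by
        refine (sq_eq_sq₀ (norm_nonneg _) (by positivity)).mp ?_
        rw [hsq2, h4, h2]
        ring
      rw [h3]
      nlinarith

theorem mapsDisk_sharpMulAdjugate_lowerTriangular_iff {a c : ℂ} (hL : MapsDisk !![a, 0; c, 1]) :
    MapsDisk (sharpMulAdjugate !![a, 0; c, 1]) ↔ c = 0 := by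
  obtain ⟨ha, -, hle⟩ := mapsDisk_lowerTriangular_iff.mp hL
  rw [norm_one] at hle
  have hr : 0 < ‖a‖ := norm_pos_iff.mpr ha
  have hs1 : ‖c‖ < 1 := by linarith
  have hcc := mul_conj_eq_norm_sq c
  constructor
  · intro h
    -- `ψ(0) = -c̄`, so postcomposition with this involution yields a map fixing `0`. The triangular
    -- criterion becomes `|a| + |c|·|…| ≤ (1-|c|²)|a|`, possible only for `c = 0`.
    have e : involutionMatrix (-conj c) * sharpMulAdjugate !![a, 0; c, 1]
        = !![-conj a, 0; c * (conj a + c * conj c - 1), (1 - ‖c‖ ^ 2 : ℝ) * a] := by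
      rw [sharpMulAdjugate_eq]
      push_cast at hcc ⊢
      ext i j
      fin_cases i <;> fin_cases j <;>
        simp [involutionMatrix, Matrix.mul_apply, Fin.sum_univ_two]
      · ring
      · linear_combination (-a) * hcc
    have h1 := (mapsDisk_involutionMatrix (w := -conj c) (by simpa using hs1)).mul h
    rw [e, mapsDisk_lowerTriangular_iff, norm_neg, RCLike.norm_conj, norm_mul, norm_mul,
      Complex.norm_real, Real.norm_of_nonneg (by nlinarith [norm_nonneg c])] at h1
    have h2 : 0 ≤ ‖c‖ * ‖conj a + c * conj c - 1‖ := by positivity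
    have h3 : ‖a‖ * ‖c‖ ^ 2 ≤ 0 := by nlinarith [h1.2.2]
    have h4 : ‖c‖ ^ 2 ≤ 0 := nonpos_of_mul_nonpos_right h3 hr
    have h5 : ‖c‖ ^ 2 = 0 := le_antisymm h4 (by positivity)
    simpa using h5
  · rintro rfl
    have e : sharpMulAdjugate !![a, 0; 0, 1] = !![conj a, 0; 0, a] := by
      rw [sharpMulAdjugate_eq]
      simp
    rw [e, mapsDisk_lowerTriangular_iff]
    exact ⟨(map_ne_zero _).mpr ha, ha, by simp⟩

/-! ### Normal form for a boundary fixed point -/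

/-- The matrix of the linear-fractional map that becomes `z ↦ l z + μ` on the right half-plane
under `z ↦ (w + z) / (w - z)`. -/
def halfPlaneMatrix (w l μ : ℂ) : Matrix (Fin 2) (Fin 2) ℂ :=
  !![w * (l - μ + 1), w ^ 2 * (l + μ - 1); l - μ - 1, w * (l + μ + 1)]

theorem det_halfPlaneMatrix (w l μ : ℂ) : (halfPlaneMatrix w l μ).det = 4 * l * w ^ 2 := by
  rw [halfPlaneMatrix, Matrix.det_fin_two_of]
  ring

theorem conj_eq_inv_of_norm_eq_one {w : ℂ} (hw : ‖w‖ = 1) : conj w = w⁻¹ :=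
  (Complex.inv_eq_conj hw).symm

/-- Transports the disk condition in homogeneous coordinates to the half-plane condition `Re(U V̄) >
0`. -/
theorem norm_sq_sub_norm_sq_halfPlane {w : ℂ} (hw : ‖w‖ = 1) (U V : ℂ) :
    ‖U + V‖ ^ 2 - ‖w * (U - V)‖ ^ 2 = 4 * (U * conj V).re := by
  rw [norm_mul, hw, one_mul, ← Complex.normSq_eq_norm_sq, ← Complex.normSq_eq_norm_sq,
    Complex.normSq_add, Complex.normSq_sub]
  ring

theorem mapsDisk_halfPlaneMatrix_iff {w l μ : ℂ} (hw : ‖w‖ = 1) (hl : l ≠ 0) :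
    MapsDisk (halfPlaneMatrix w l μ) ↔ l.im = 0 ∧ 0 < l.re ∧ 0 ≤ μ.re := by
  have hw0 : w ≠ 0 := norm_ne_zero_iff.mp (by rw [hw]; exact one_ne_zero)
  have key : ∀ x y : ℂ, ‖(halfPlaneMatrix w l μ) 1 0 * x + (halfPlaneMatrix w l μ) 1 1 * y‖ ^ 2
      - ‖(halfPlaneMatrix w l μ) 0 0 * x + (halfPlaneMatrix w l μ) 0 1 * y‖ ^ 2
      = 4 * ((l * (w * y + x) + μ * (w * y - x)) * conj (w * y - x)).re := fun x y => by
    rw [← norm_sq_sub_norm_sq_halfPlane hw]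
    simp only [halfPlaneMatrix, Matrix.of_apply, Matrix.cons_val', Matrix.cons_val_zero,
      Matrix.cons_val_one, Matrix.cons_val_fin_one]
    ring_nf
  have key0 : ∀ x y : ℂ, ‖y‖ ^ 2 - ‖x‖ ^ 2 = ((w * y + x) * conj (w * y - x)).re := fun x y => by
    have h := norm_sq_sub_norm_sq_halfPlane hw (w * y + x) (w * y - x)
    have e1 : w * y + x + (w * y - x) = 2 * (w * y) := by ring
    have e2 : w * (w * y + x - (w * y - x)) = 2 * (w * x) := by ring
    rw [e1, e2, norm_mul, norm_mul, norm_mul, norm_mul, hw, Complex.norm_two] at h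
    linarith
  constructor
  · intro h
    have hX : ∀ X : ℂ, 0 < X.re → 0 < (l * X).re + μ.re := fun X hXre => by
      -- The pair `((X-1)/2, (X+1)/(2w))` is the homogeneous disk point corresponding to `X` in the
      -- half-plane.
      have e1 : w * ((X + 1) / (2 * w)) + (X - 1) / 2 = X := by field_simp; ring
      have e2 : w * ((X + 1) / (2 * w)) - (X - 1) / 2 = 1 := by field_simp; ring
      have h2 := key0 ((X - 1) / 2) ((X + 1) / (2 * w))
      have h3 := key ((X - 1) / 2) ((X + 1) / (2 * w))
      rw [e1, e2, map_one, mul_one] at h2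
      rw [e1, e2, map_one, mul_one, mul_one, Complex.add_re] at h3
      have h4 := h.norm_lt ((X - 1) / 2) ((X + 1) / (2 * w))
        (lt_of_pow_lt_pow_left₀ 2 (norm_nonneg _) (by linarith))
      have h5 := pow_lt_pow_left₀ h4 (norm_nonneg _) two_ne_zero
      linarith
    have him : l.im = 0 := by
      by_contra h0
      -- The imaginary part is chosen so that `Re(lX + μ) = 0`.
      have h1 := hX ⟨1, (l.re + μ.re) / l.im⟩ one_pos
      rw [Complex.mul_re, mul_one, mul_div_cancel₀ _ h0] at h1
      linarith
    have hX' : ∀ x : ℝ, 0 < x → 0 < l.re * x + μ.re := fun x hx => by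
      have := hX x (by simpa using hx)
      rwa [Complex.mul_re, him, zero_mul, sub_zero, Complex.ofReal_re] at this
    have hμ : 0 ≤ μ.re := by
      by_contra! h0
      rcases le_or_gt l.re 0 with h1 | h1
      · have := hX' 1 one_pos
        linarith
      · have := hX' (-μ.re / l.re) (div_pos (by linarith) h1)
        rw [mul_div_cancel₀ _ h1.ne'] at this
        linarith
    refine ⟨him, ?_, hμ⟩
    have hre : l.re ≠ 0 := fun h0 => hl (Complex.ext h0 him)
    by_contra! h0
    have h0' : l.re < 0 := lt_of_le_of_ne h0 hre
    have := hX' ((μ.re + 1) / -l.re) (div_pos (by linarith) (by linarith))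
    have e : l.re * ((μ.re + 1) / -l.re) = -(μ.re + 1) := by field_simp
    rw [e] at this
    linarith
  · rintro ⟨him, hre, hμ⟩
    refine ⟨?_, fun x y hxy => ?_⟩
    · rw [det_halfPlaneMatrix]
      exact mul_ne_zero (mul_ne_zero (by norm_num) hl) (pow_ne_zero _ hw0)
    · refine lt_of_pow_lt_pow_left₀ 2 (norm_nonneg _) ?_
      have h1 := key x y
      have h2 := key0 x y
      have h3 := pow_lt_pow_left₀ hxy (norm_nonneg _) two_ne_zero
      have e : (l * (w * y + x) + μ * (w * y - x)) * conj (w * y - x)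
          = l * ((w * y + x) * conj (w * y - x)) + (Complex.normSq (w * y - x) : ℝ) * μ := by
        rw [← Complex.mul_conj]; ring
      rw [e, Complex.add_re, Complex.mul_re, him, zero_mul, sub_zero, ← h2,
        Complex.re_ofReal_mul] at h1
      have h4 := Complex.normSq_nonneg (w * y - x)
      nlinarith [mul_nonneg h4 hμ, mul_pos hre (sub_pos.mpr h3)]

theorem mulSharpAdjugate_halfPlaneMatrix {w : ℂ} (hw : ‖w‖ = 1) (l : ℝ) (μ : ℂ) :
    mulSharpAdjugate (halfPlaneMatrix w l μ)
      = (2 * conj w) • halfPlaneMatrix w (l ^ 2) (μ - l * conj μ) := by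
  have hw0 : w ≠ 0 := norm_ne_zero_iff.mp (by rw [hw]; exact one_ne_zero)
  rw [mulSharpAdjugate_eq]
  ext i j
  fin_cases i <;> fin_cases j <;>
    simp [halfPlaneMatrix, conj_eq_inv_of_norm_eq_one hw] <;> field_simp <;> ring

theorem sharpMulAdjugate_halfPlaneMatrix {w : ℂ} (hw : ‖w‖ = 1) {l : ℝ} (hl : l ≠ 0) (μ : ℂ) :
    sharpMulAdjugate (halfPlaneMatrix w l μ)
      = (2 * (l : ℂ) ^ 2 * conj w) •
        halfPlaneMatrix w ((l : ℂ) ^ 2)⁻¹ ((l * conj μ - μ) / (l : ℂ) ^ 2) := by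
  have hw0 : w ≠ 0 := norm_ne_zero_iff.mp (by rw [hw]; exact one_ne_zero)
  have hl' : (l : ℂ) ≠ 0 := Complex.ofReal_ne_zero.mpr hl
  rw [sharpMulAdjugate_eq]
  ext i j
  fin_cases i <;> fin_cases j <;>
    simp [halfPlaneMatrix, conj_eq_inv_of_norm_eq_one hw] <;> field_simp <;> ring

theorem adjugate_halfPlaneMatrix (w : ℂ) {l : ℂ} (hl : l ≠ 0) (μ : ℂ) :
    (halfPlaneMatrix w l μ).adjugate = l • halfPlaneMatrix w l⁻¹ (-μ / l) := by
  rw [halfPlaneMatrix, Matrix.adjugate_fin_two_of]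
  ext i j
  fin_cases i <;> fin_cases j <;> simp [halfPlaneMatrix] <;> field_simp <;> ring

/-- In the half-plane a map fixing infinity is affine. The values of `k`, `l` and `μ` are read off
from the entries of the normal form; that `l` is real and positive and `Re μ ≥ 0` comes from
`mapsDisk_halfPlaneMatrix_iff`. -/
theorem exists_eq_smul_halfPlaneMatrix {M : Matrix (Fin 2) (Fin 2) ℂ} (hM : MapsDisk M) {w : ℂ}
    (hw : ‖w‖ = 1) (hfix : M 0 0 * w + M 0 1 = w * (M 1 0 * w + M 1 1)) :
    ∃ (k : ℂ) (l : ℝ) (μ : ℂ), k ≠ 0 ∧ 0 < l ∧ 0 ≤ μ.re ∧ M = k • halfPlaneMatrix w l μ := by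
  have hw0 : w ≠ 0 := norm_ne_zero_iff.mp (by rw [hw]; exact one_ne_zero)
  have hdet := hM.det_ne_zero
  rw [Matrix.det_fin_two] at hdet
  have hν := hM.denom_ne_zero hw.le
  set t := M 0 0 - M 1 0 * w with ht
  have ht0 : t ≠ 0 := by
    contrapose! hdet
    linear_combination (M 1 0 * w + M 1 1) * hdet - M 1 0 * hfix
  set k := t / (2 * w) with hk
  have hk0 : k ≠ 0 := div_ne_zero ht0 (mul_ne_zero two_ne_zero hw0)
  set l := (M 1 0 * w + M 1 1) / t with hl
  set μ := (M 1 1 - M 1 0 * w) / t - 1 with hμ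
  have hMP : M = k • halfPlaneMatrix w l μ := by
    have h01 : M 0 1 = w * (M 1 1 - t) := by linear_combination hfix
    have h00 : M 0 0 = t + M 1 0 * w := by rw [ht]; ring
    ext i j
    fin_cases i <;> fin_cases j
    · simp only [Fin.zero_eta, h00, halfPlaneMatrix, hk, hl, hμ, Matrix.smul_apply, smul_eq_mul,
        Matrix.of_apply, Matrix.cons_val', Matrix.cons_val_zero, Matrix.cons_val_fin_one]
      field_simp; ring
    · simp only [Fin.zero_eta, Fin.mk_one, h01, halfPlaneMatrix, hk, hl, hμ, Matrix.smul_apply,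
        smul_eq_mul, Matrix.of_apply, Matrix.cons_val', Matrix.cons_val_zero, Matrix.cons_val_one,
        Matrix.cons_val_fin_one]
      field_simp; ring
    · simp only [Fin.zero_eta, Fin.mk_one, halfPlaneMatrix, hk, hl, hμ, Matrix.smul_apply,
        smul_eq_mul, Matrix.of_apply, Matrix.cons_val', Matrix.cons_val_zero, Matrix.cons_val_one,
        Matrix.cons_val_fin_one]
      field_simp; ring
    · simp only [Fin.mk_one, halfPlaneMatrix, hk, hl, hμ, Matrix.smul_apply,
        smul_eq_mul, Matrix.of_apply, Matrix.cons_val', Matrix.cons_val_one,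
        Matrix.cons_val_fin_one]
      field_simp; ring
  have hl0 : l ≠ 0 := div_ne_zero hν ht0
  have hP := hM
  rw [hMP, MapsDisk.smul_iff hk0, mapsDisk_halfPlaneMatrix_iff hw hl0] at hP
  have hlr : (l.re : ℂ) = l := Complex.ext (by simp) (by simp [hP.1])
  exact ⟨k, l.re, μ, hk0, hP.2.1, hP.2.2, by rw [hlr]; exact hMP⟩

/-! ### Translation between matrices and functions -/

/-- The linear-fractional function of a matrix. -/
noncomputable def mobius (M : Matrix (Fin 2) (Fin 2) ℂ) : ℂ → ℂ :=
  linearFractional (M 0 0) (M 0 1) (M 1 0) (M 1 1)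

namespace MapsDisk

variable {M L : Matrix (Fin 2) (Fin 2) ℂ}

theorem mobius_eq_iff (hM : MapsDisk M) {z : ℂ} (hz : ‖z‖ ≤ 1) (v : ℂ) :
    mobius M z = v ↔ M 0 0 * z + M 0 1 = v * (M 1 0 * z + M 1 1) :=
  div_eq_iff (hM.denom_ne_zero hz)

theorem coe_toDisc (hM : MapsDisk M) (z : 𝔻) : (hM.toDisc z : ℂ) = mobius M z := rfl

theorem isDiskAutomorphism_mobius_iff (hM : MapsDisk M) :
    IsDiskAutomorphism (mobius M) ↔ MapsDisk M.adjugate := by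
  have hdet := hM.det_ne_zero
  have hdetA : M.adjugate.det ≠ 0 := by
    rw [Matrix.det_adjugate]
    simpa using hdet
  rw [Matrix.det_fin_two] at hdet
  constructor
  · intro h
    refine of_forall_norm_lt_one hdetA fun z hz => ?_
    obtain ⟨u, hu, huz⟩ := h.surjOn (show z ∈ Metric.ball (0 : ℂ) 1 by simpa using hz)
    have hu' : ‖u‖ < 1 := by simpa using hu
    rw [hM.mobius_eq_iff hu'.le] at huz
    have hs := hM.denom_ne_zero hu'.le
    rw [Matrix.adjugate_fin_two]
    change ‖M 1 1 * z + -M 0 1‖ < ‖-M 1 0 * z + M 0 0‖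
    have e1 : (M 1 0 * u + M 1 1) * (M 1 1 * z + -M 0 1)
        = (M 0 0 * M 1 1 - M 0 1 * M 1 0) * u := by linear_combination (-M 1 1) * huz
    have e2 : (M 1 0 * u + M 1 1) * (-M 1 0 * z + M 0 0)
        = (M 0 0 * M 1 1 - M 0 1 * M 1 0) := by linear_combination M 1 0 * huz
    refine lt_of_mul_lt_mul_left ?_ (norm_nonneg (M 1 0 * u + M 1 1))
    rw [← norm_mul, ← norm_mul, e1, e2, norm_mul]
    exact mul_lt_of_lt_one_right (norm_pos_iff.mpr hdet) hu'
  · intro hA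
    refine ⟨fun z hz => ?_, fun u hu v hv huv => ?_, fun z hz => ?_⟩
    · simpa [mobius] using hM.norm_linearFractional_lt_one (by simpa using hz)
    · have hu' : ‖u‖ < 1 := by simpa using hu
      have hv' : ‖v‖ < 1 := by simpa using hv
      have h1 := (hM.mobius_eq_iff hu'.le _).mp rfl
      have h2 := (hM.mobius_eq_iff hv'.le _).mp rfl
      rw [huv] at h1
      have hsu := hM.denom_ne_zero hu'.le
      have hsv := hM.denom_ne_zero hv'.le
      have h3 : (M 0 0 * M 1 1 - M 0 1 * M 1 0) * (u - v) = 0 := by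
        linear_combination (M 1 0 * v + M 1 1) * h1 - (M 1 0 * u + M 1 1) * h2
      exact sub_eq_zero.mp ((mul_eq_zero.mp h3).resolve_left hdet)
    · have hz' : ‖z‖ < 1 := by simpa using hz
      set u := hA.toDisc (.mk z hz') with hu
      have h1 := hA.coe_toDisc_mul (.mk z hz')
      have h0 := hA.denom_ne_zero hz'.le
      rw [← hu, Complex.UnitDisc.coe_mk, Matrix.adjugate_fin_two] at h1
      rw [Matrix.adjugate_fin_two] at h0
      change -M 1 0 * z + M 0 0 ≠ 0 at h0
      change (u : ℂ) * (-M 1 0 * z + M 0 0) = M 1 1 * z + -M 0 1 at h1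
      refine ⟨u, by simpa using u.norm_lt_one, ?_⟩
      rw [hM.mobius_eq_iff u.norm_lt_one.le]
      refine mul_right_cancel₀ h0 ?_
      linear_combination (M 0 0 - z * M 1 0) * h1

theorem vanishesInDisk_mobius_iff (hM : MapsDisk M) :
    VanishesInDisk (mobius M) ↔ ‖M 0 1‖ < ‖M 0 0‖ := by
  have hdet := hM.det_ne_zero
  rw [Matrix.det_fin_two] at hdet
  constructor
  · rintro ⟨β, hβ, h⟩
    rw [hM.mobius_eq_iff hβ.le, zero_mul] at h
    have ha : M 0 0 ≠ 0 := by
      intro ha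
      rw [ha, zero_mul, zero_add] at h
      exact hdet (by rw [ha, h]; ring)
    rw [eq_neg_of_add_eq_zero_right h, norm_neg, norm_mul]
    exact mul_lt_of_lt_one_right (norm_pos_iff.mpr ha) hβ
  · intro h
    have ha' : 0 < ‖M 0 0‖ := (norm_nonneg _).trans_lt h
    have ha : M 0 0 ≠ 0 := norm_pos_iff.mp ha'
    have hβ : ‖-M 0 1 / M 0 0‖ < 1 := by rwa [norm_div, norm_neg, div_lt_one ha']
    refine ⟨-M 0 1 / M 0 0, hβ, ?_⟩
    rw [hM.mobius_eq_iff hβ.le]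
    field_simp
    ring

end MapsDisk

theorem IsDenjoyWolffPoint.eq_of_fixed {φ : ℂ → ℂ} {w p : ℂ} (h : IsDenjoyWolffPoint φ w)
    (hp : ‖p‖ < 1) (hfix : φ p = p) : p = w := by
  have h1 := h.tendsto_iterate.tendsto_at (show p ∈ Metric.ball (0 : ℂ) 1 by simpa using hp)
  have h2 : (fun n : ℕ => φ^[n] p) = fun _ => p := funext fun n => Function.iterate_fixed hfix n
  rw [h2] at h1
  exact tendsto_nhds_unique tendsto_const_nhds h1

/-! ### Interior fixed points -/

section Interior

variable {M : Matrix (Fin 2) (Fin 2) ℂ} {w a c k : ℂ}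

theorem exists_involution_conj_eq_smul (hM : MapsDisk M) (hw : ‖w‖ < 1)
    (hfix : M 0 0 * w + M 0 1 = w * (M 1 0 * w + M 1 1)) :
    ∃ a c k : ℂ, k ≠ 0 ∧ MapsDisk !![a, 0; c, 1] ∧
      involutionMatrix w * M * involutionMatrix w = k • !![a, 0; c, 1] := by
  have hM' := (MapsDisk.involution_conj_iff hw).mpr hM
  have h01 : (involutionMatrix w * M * involutionMatrix w) 0 1 = 0 := by
    simp only [Matrix.mul_apply, Fin.sum_univ_two,
      involutionMatrix, Matrix.of_apply, Matrix.cons_val', Matrix.cons_val_zero,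
      Matrix.cons_val_one, Matrix.cons_val_fin_one]
    linear_combination -hfix
  set M' := involutionMatrix w * M * involutionMatrix w
  have hk : M' 1 1 ≠ 0 := by simpa using hM'.denom_ne_zero (z := 0) (by simp)
  have e : M' = M' 1 1 • !![M' 0 0 / M' 1 1, 0; M' 1 0 / M' 1 1, 1] := by
    ext i j
    fin_cases i <;> fin_cases j <;> simp [h01] <;> field_simp
  refine ⟨M' 0 0 / M' 1 1, M' 1 0 / M' 1 1, M' 1 1, hk, ?_, e⟩
  rwa [← MapsDisk.smul_iff hk, ← e]

theorem toDisc_involution_involution (hN : MapsDisk (involutionMatrix w)) (z : 𝔻) :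
    hN.toDisc (hN.toDisc z) = z := by
  rw [← MapsDisk.toDisc_mul hN hN]
  refine Complex.UnitDisc.coe_injective ?_
  rw [MapsDisk.coe_toDisc_eq_iff, involutionMatrix_mul_self]
  simp
  ring

theorem coe_toDisc_involution (hN : MapsDisk (involutionMatrix w)) (z : 𝔻) :
    (hN.toDisc z : ℂ) = diskInvolution w z := by
  rw [MapsDisk.coe_toDisc, mobius, linearFractional, diskInvolution]
  simp only [involutionMatrix, Matrix.of_apply, Matrix.cons_val', Matrix.cons_val_zero,
    Matrix.cons_val_one, Matrix.cons_val_fin_one]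
  congr 1 <;> ring

theorem toDisc_eq_of_conj (hM : MapsDisk M) (hN : MapsDisk (involutionMatrix w))
    (hL : MapsDisk !![a, 0; c, 1])
    (h : involutionMatrix w * M * involutionMatrix w = k • !![a, 0; c, 1]) (z : 𝔻) :
    hM.toDisc z = hN.toDisc (hL.toDisc (hN.toDisc z)) := by
  rw [← MapsDisk.toDisc_toDisc_eq (hN.mul hM) hN hL h, toDisc_involution_involution,
    MapsDisk.toDisc_mul hN hM, toDisc_involution_involution]

theorem isConjugateOfDilation_of_conj (hM : MapsDisk M) (hw : ‖w‖ < 1)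
    (hL : MapsDisk !![a, 0; 0, 1])
    (h : involutionMatrix w * M * involutionMatrix w = k • !![a, 0; 0, 1]) :
    IsConjugateOfDilation (mobius M) w a := by
  have hN := mapsDisk_involutionMatrix hw
  intro z hz
  have h1 := congrArg Complex.UnitDisc.coe (toDisc_eq_of_conj hM hN hL h (.mk z hz))
  have h2 := hL.coe_toDisc_mul (hN.toDisc (.mk z hz))
  simp only [Matrix.of_apply, Matrix.cons_val', Matrix.cons_val_zero,
    Matrix.cons_val_one, Matrix.cons_val_fin_one, zero_mul, zero_add, mul_one, add_zero] at h2
  rwa [coe_toDisc_involution, h2, coe_toDisc_involution] at h1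

theorem eq_zero_and_eq_of_isConjugateOfDilation {α : ℂ} (hM : MapsDisk M) (hw : ‖w‖ < 1)
    (hL : MapsDisk !![a, 0; c, 1])
    (h : involutionMatrix w * M * involutionMatrix w = k • !![a, 0; c, 1]) (hα : ‖α‖ < 1)
    (hconj : IsConjugateOfDilation (mobius M) w α) : c = 0 ∧ a = α := by
  have hN := mapsDisk_involutionMatrix hw
  have ha : a ≠ 0 := (mapsDisk_lowerTriangular_iff.mp hL).1
  have key : ∀ x : 𝔻, a * (x : ℂ) = α * x * (c * x + 1) := fun x => by
    have hαx : ‖α * (x : ℂ)‖ < 1 := by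
      rw [norm_mul]
      exact mul_lt_one_of_nonneg_of_lt_one_left (norm_nonneg _) hα x.norm_lt_one.le
    have h1 := hconj (hN.toDisc x) (hN.toDisc x).norm_lt_one
    rw [← hM.coe_toDisc, ← coe_toDisc_involution hN, toDisc_involution_involution,
      toDisc_eq_of_conj hM hN hL h, toDisc_involution_involution,
      ← Complex.UnitDisc.coe_mk _ hαx, ← coe_toDisc_involution hN, Complex.UnitDisc.coe_inj] at h1
    have h2 := congrArg hN.toDisc h1
    rw [toDisc_involution_involution, toDisc_involution_involution] at h2
    have h3 := hL.coe_toDisc_mul x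
    rw [h2] at h3
    simpa using h3.symm
  -- The relation `ax = αx(cx+1)` at `±1/2` separates its odd part, giving `a = α`, from its even
  -- part, giving `αc = 0`.
  have h1 := key (.mk (1 / 2) (by norm_num))
  have h2 := key (.mk (-1 / 2) (by norm_num))
  rw [Complex.UnitDisc.coe_mk] at h1 h2
  have haα : a = α := by linear_combination h1 - h2
  refine ⟨?_, haα⟩
  have h3 : a * c = 0 := by rw [haα] at *; linear_combination -2 * (h1 + h2)
  exact (mul_eq_zero.mp h3).resolve_left ha

/-- `τ(q)` has modulus one and is a nonzero fixed point of `az/(cz+1)`, so `a - 1 = c τ(q)`. -/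
theorem norm_one_sub_eq_of_boundary_fixed (hM : MapsDisk M) (hw : ‖w‖ < 1) (hk : k ≠ 0)
    (h : involutionMatrix w * M * involutionMatrix w = k • !![a, 0; c, 1]) {q : ℂ}
    (hq : ‖q‖ = 1) (hfix : mobius M q = q) : ‖1 - a‖ = ‖c‖ := by
  rw [hM.mobius_eq_iff hq.le] at hfix
  have h1 : (1 - w * conj w) • (involutionMatrix w * M)
      = k • (!![a, 0; c, 1] * involutionMatrix w) := by
    rw [← Matrix.smul_mul k, ← h, mul_assoc _ (involutionMatrix w), involutionMatrix_mul_self]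
    simp
  have e00 := congrFun (congrFun h1 0) 0
  have e01 := congrFun (congrFun h1 0) 1
  have e10 := congrFun (congrFun h1 1) 0
  have e11 := congrFun (congrFun h1 1) 1
  simp only [Matrix.mul_apply, Matrix.smul_apply, smul_eq_mul, Fin.sum_univ_two,
    involutionMatrix, Matrix.of_apply, Matrix.cons_val', Matrix.cons_val_zero,
    Matrix.cons_val_one, Matrix.cons_val_fin_one] at e00 e01 e10 e11
  have hqq : q * conj q = 1 := by rw [mul_conj_eq_norm_sq, hq]; simp
  have hx : w - q ≠ 0 := by
    intro h0
    rw [sub_eq_zero.mp h0, hq] at hw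
    exact lt_irrefl _ hw
  have hy : 1 - conj w * q = -q * conj (w - q) := by
    rw [map_sub]
    linear_combination -hqq
  have hnorm : ‖1 - conj w * q‖ = ‖w - q‖ := by
    rw [hy, norm_mul, norm_neg, hq, one_mul, RCLike.norm_conj]
  have hkey : k * (w - q) * ((a - 1) * (1 - conj w * q) - c * (w - q)) = 0 := by
    linear_combination (w - q) * (q * e10 + e11) - (1 - conj w * q) * (q * e00 + e01)
      - (1 - w * conj w) * (1 - w * conj w) * hfix
  have h2 : (a - 1) * (1 - conj w * q) = c * (w - q) :=
    sub_eq_zero.mp ((mul_eq_zero.mp hkey).resolve_left (mul_ne_zero hk hx))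
  have h3 := congrArg norm h2
  rw [norm_mul, norm_mul, hnorm] at h3
  rw [norm_sub_rev]
  exact mul_right_cancel₀ (norm_ne_zero_iff.mpr hx) h3

theorem exists_boundary_fixed_of_norm_one_sub_eq (hM : MapsDisk M) (hw : ‖w‖ < 1)
    (h : involutionMatrix w * M * involutionMatrix w = k • !![a, 0; c, 1]) (hc : c ≠ 0)
    (hac : ‖1 - a‖ = ‖c‖) : ∃ q : ℂ, ‖q‖ = 1 ∧ mobius M q = q := by
  have hκ := one_sub_mul_conj_ne_zero hw
  have h1 : (1 - w * conj w) • (M * involutionMatrix w)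
      = k • (involutionMatrix w * !![a, 0; c, 1]) := by
    rw [← Matrix.mul_smul _ k, ← h, mul_assoc, ← mul_assoc (involutionMatrix w),
      involutionMatrix_mul_self]
    simp
  have e00 := congrFun (congrFun h1 0) 0
  have e01 := congrFun (congrFun h1 0) 1
  have e10 := congrFun (congrFun h1 1) 0
  have e11 := congrFun (congrFun h1 1) 1
  simp only [Matrix.mul_apply, Matrix.smul_apply, smul_eq_mul, Fin.sum_univ_two,
    involutionMatrix, Matrix.of_apply, Matrix.cons_val', Matrix.cons_val_zero,
    Matrix.cons_val_one, Matrix.cons_val_fin_one] at e00 e01 e10 e11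
  -- The nonzero fixed point of `az/(cz+1)`; the required point is `q = τ(x)`.
  set x := (a - 1) / c with hx
  have hcx : c * x = a - 1 := by rw [hx]; field_simp
  have hxn : ‖x‖ = 1 := by
    rw [hx, norm_div, norm_sub_rev, hac, div_self (norm_ne_zero_iff.mpr hc)]
  have hxx : x * conj x = 1 := by rw [mul_conj_eq_norm_sq, hxn]; simp
  have hwx : w - x ≠ 0 := by
    intro h0
    rw [sub_eq_zero.mp h0, hxn] at hw
    exact lt_irrefl _ hw
  have hy : 1 - conj w * x = -x * conj (w - x) := by
    rw [map_sub]
    linear_combination -hxx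
  have hnorm : ‖1 - conj w * x‖ = ‖w - x‖ := by
    rw [hy, norm_mul, norm_neg, hxn, one_mul, RCLike.norm_conj]
  have hy0 : 1 - conj w * x ≠ 0 := by
    rw [← norm_ne_zero_iff, hnorm, norm_ne_zero_iff]
    exact hwx
  have hq : ‖(w - x) / (1 - conj w * x)‖ = 1 := by
    rw [norm_div, hnorm, div_self (norm_ne_zero_iff.mpr hwx)]
  refine ⟨_, hq, ?_⟩
  rw [hM.mobius_eq_iff hq.le]
  have f1 : (1 - w * conj w) * (M 0 0 * (w - x) + M 0 1 * (1 - conj w * x)) = k * a * (w - x) := by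
    linear_combination x * e00 + e01 + k * w * hcx
  have f2 : (1 - w * conj w) * (M 1 0 * (w - x) + M 1 1 * (1 - conj w * x))
      = k * a * (1 - conj w * x) := by
    linear_combination x * e10 + e11 + k * hcx
  have f3 : (M 0 0 * (w - x) + M 0 1 * (1 - conj w * x)) * (1 - conj w * x)
      = (w - x) * (M 1 0 * (w - x) + M 1 1 * (1 - conj w * x)) := by
    refine mul_left_cancel₀ hκ ?_
    linear_combination (1 - conj w * x) * f1 - (w - x) * f2
  generalize w - x = X at f3 ⊢
  generalize 1 - conj w * x = Y at f3 hy0 ⊢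
  field_simp
  linear_combination f3

theorem isDiskAutomorphism_of_conj (hM : MapsDisk M) (hw : ‖w‖ < 1) (hk : k ≠ 0)
    (h : involutionMatrix w * M * involutionMatrix w = k • !![a, 0; 0, 1]) (ha : ‖a‖ = 1) :
    IsDiskAutomorphism (mobius M) := by
  have ha0 : a ≠ 0 := norm_ne_zero_iff.mp (by rw [ha]; exact one_ne_zero)
  rw [hM.isDiskAutomorphism_mobius_iff]
  have h1 : involutionMatrix w * M.adjugate * involutionMatrix w = k • !![1, 0; 0, a] := by
    have h2 := congrArg Matrix.adjugate h
    rw [Matrix.adjugate_mul_distrib, Matrix.adjugate_mul_distrib, adjugate_involutionMatrix,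
      Matrix.adjugate_smul, Matrix.adjugate_fin_two_of] at h2
    simpa [mul_assoc] using h2
  rw [← MapsDisk.involution_conj_iff hw, h1, MapsDisk.smul_iff hk, mapsDisk_lowerTriangular_iff]
  exact ⟨one_ne_zero, ha0, by simp [ha]⟩

theorem posinormal_iff_of_norm_lt_one (hM : MapsDisk M) (hDW : IsDenjoyWolffPoint (mobius M) w)
    (hw : ‖w‖ < 1) :
    IsPosinormal (compositionOperator hM.toDisc) ↔
      IsDiskAutomorphism (mobius M) ∨
      (∃ α : ℂ, ‖α‖ < 1 ∧ ‖w‖ < ‖α‖ ∧ IsConjugateOfDilation (mobius M) w α) ∨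
      (‖w‖ = 1 ∧ deriv (mobius M) w = 1 ∧ VanishesInDisk (mobius M)) ∨
      ((∃ p : ℂ, ‖p‖ < 1 ∧ mobius M p = p) ∧ (∃ q : ℂ, ‖q‖ = 1 ∧ mobius M q = q) ∧
        VanishesInDisk (mobius M)) := by
  have hN := mapsDisk_involutionMatrix hw
  obtain ⟨a, c, k, hk, hL, h⟩ := exists_involution_conj_eq_smul hM hw
    ((hM.mobius_eq_iff hw.le w).mp hDW.fixed)
  obtain ⟨ha, -, hle⟩ := mapsDisk_lowerTriangular_iff.mp hL
  rw [norm_one] at hle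
  have hiff : IsPosinormal (compositionOperator hM.toDisc) ↔
      VanishesInDisk (mobius M) ∧ (c = 0 ∨ ‖1 - a‖ = ‖c‖) := by
    rw [hM.isPosinormal_compositionOperator_iff, hM.vanishesInDisk_mobius_iff,
      MapsDisk.mulSharpAdjugate_iff_of_conj hw hk h,
      mapsDisk_mulSharpAdjugate_lowerTriangular_iff hL]
  constructor
  · intro hpos
    obtain ⟨hv, hc⟩ := hiff.mp hpos
    by_cases hc0 : c = 0
    · subst hc0
      have hconj := isConjugateOfDilation_of_conj hM hw hL h
      rw [norm_zero, add_zero] at hle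
      rcases hle.lt_or_eq with ha1 | ha1
      · refine Or.inr (Or.inl ⟨a, ha1, ?_, hconj⟩)
        -- At the zero `β` of `φ`, applying `τ` to `τ(aτ(β)) = 0` gives `w = aτ(β)`, hence `|w| <
        -- |a|`. The converse takes `β = τ(w/a)`.
        obtain ⟨β, hβ, hβ0⟩ := hv
        have h1 := toDisc_eq_of_conj hM hN hL h (.mk β hβ)
        have h2 : hM.toDisc (.mk β hβ) = 0 := Complex.UnitDisc.coe_injective hβ0
        have h3 := congrArg (fun z => (hN.toDisc z : ℂ)) h1
        have h4 := hL.coe_toDisc_mul (hN.toDisc (.mk β hβ))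
        simp only [Matrix.of_apply, Matrix.cons_val', Matrix.cons_val_zero, Matrix.cons_val_one,
          Matrix.cons_val_fin_one, zero_mul, zero_add, mul_one, add_zero] at h4
        simp only [h2, toDisc_involution_involution, coe_toDisc_involution, h4,
          Complex.UnitDisc.coe_zero] at h3
        have h5 : w = a * diskInvolution w (Complex.UnitDisc.mk β hβ) := by
          simpa [diskInvolution] using h3
        have h6 := (hN.toDisc (.mk β hβ)).norm_lt_one
        rw [coe_toDisc_involution] at h6
        rw [congrArg norm h5, norm_mul]
        exact mul_lt_of_lt_one_right (norm_pos_iff.mpr ha) h6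
      · exact Or.inl (isDiskAutomorphism_of_conj hM hw hk h ha1)
    · exact Or.inr (Or.inr (Or.inr ⟨⟨w, hw, hDW.fixed⟩, exists_boundary_fixed_of_norm_one_sub_eq hM
        hw h hc0 (hc.resolve_left hc0), hv⟩))
  · rintro (hauto | ⟨α, hα, hwα, hconj⟩ | ⟨hw1, -⟩ | ⟨-, ⟨q, hq, hqfix⟩, hv⟩)
    · exact (hM.isPosinormal_and_isCoposinormal_of_adjugate
        (hM.isDiskAutomorphism_mobius_iff.mp hauto)).1
    · obtain ⟨rfl, rfl⟩ := eq_zero_and_eq_of_isConjugateOfDilation hM hw hL h hα hconj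
      refine hiff.mpr ⟨?_, Or.inl rfl⟩
      have hα0 : 0 < ‖a‖ := (norm_nonneg _).trans_lt hwα
      have hwa : ‖w / a‖ < 1 := by rwa [norm_div, div_lt_one hα0]
      set β := hN.toDisc (.mk (w / a) hwa) with hβ
      refine ⟨β, β.norm_lt_one, ?_⟩
      rw [hconj β β.norm_lt_one, ← coe_toDisc_involution hN, hβ, toDisc_involution_involution,
        Complex.UnitDisc.coe_mk, mul_div_cancel₀ _ ha, diskInvolution, sub_self, zero_div]
    · exact absurd hw1 hw.ne
    · exact hiff.mpr ⟨hv, Or.inr (norm_one_sub_eq_of_boundary_fixed hM hw hk h hq hqfix)⟩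

theorem coposinormal_iff_of_norm_lt_one (hM : MapsDisk M) (hDW : IsDenjoyWolffPoint (mobius M) w)
    (hw : ‖w‖ < 1) :
    IsCoposinormal (compositionOperator hM.toDisc) ↔
      IsDiskAutomorphism (mobius M) ∨ ‖w‖ = 1 ∨
      (‖w‖ < 1 ∧ ∃ α : ℂ, 0 < ‖α‖ ∧ ‖α‖ < 1 ∧ IsConjugateOfDilation (mobius M) w α) := by
  obtain ⟨a, c, k, hk, hL, h⟩ := exists_involution_conj_eq_smul hM hw
    ((hM.mobius_eq_iff hw.le w).mp hDW.fixed)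
  obtain ⟨ha, -, hle⟩ := mapsDisk_lowerTriangular_iff.mp hL
  rw [norm_one] at hle
  have hiff : IsCoposinormal (compositionOperator hM.toDisc) ↔ c = 0 := by
    rw [hM.isCoposinormal_compositionOperator_iff, MapsDisk.sharpMulAdjugate_iff_of_conj hw hk h,
      mapsDisk_sharpMulAdjugate_lowerTriangular_iff hL]
  constructor
  · intro hcop
    obtain rfl := hiff.mp hcop
    rw [norm_zero, add_zero] at hle
    rcases hle.lt_or_eq with ha1 | ha1
    · exact Or.inr (Or.inr ⟨hw, a, norm_pos_iff.mpr ha, ha1,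
        isConjugateOfDilation_of_conj hM hw hL h⟩)
    · exact Or.inl (isDiskAutomorphism_of_conj hM hw hk h ha1)
  · rintro (hauto | hw1 | ⟨-, α, -, hα, hconj⟩)
    · exact (hM.isPosinormal_and_isCoposinormal_of_adjugate
        (hM.isDiskAutomorphism_mobius_iff.mp hauto)).2
    · exact absurd hw1 hw.ne
    · exact hiff.mpr (eq_zero_and_eq_of_isConjugateOfDilation hM hw hL h hα hconj).1

end Interior

/-! ### Boundary Denjoy–Wolff points -/

section Boundary

variable {M : Matrix (Fin 2) (Fin 2) ℂ} {w k μ : ℂ} {l : ℝ}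

theorem isDiskAutomorphism_of_halfPlane (hM : MapsDisk M) (hw : ‖w‖ = 1) (hk : k ≠ 0)
    (hl : 0 < l) (h : M = k • halfPlaneMatrix w l μ) (hμ : μ.re = 0) :
    IsDiskAutomorphism (mobius M) := by
  have hl0 : (l : ℂ) ≠ 0 := Complex.ofReal_ne_zero.mpr hl.ne'
  rw [hM.isDiskAutomorphism_mobius_iff, h, Matrix.adjugate_smul, adjugate_halfPlaneMatrix _ hl0,
    MapsDisk.smul_iff (pow_ne_zero _ hk), MapsDisk.smul_iff hl0,
    mapsDisk_halfPlaneMatrix_iff hw (inv_ne_zero hl0)]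
  refine ⟨?_, ?_, ?_⟩
  · rw [← Complex.ofReal_inv, Complex.ofReal_im]
  · rw [← Complex.ofReal_inv, Complex.ofReal_re]
    exact inv_pos.mpr hl
  · rw [Complex.div_ofReal_re, Complex.neg_re, hμ, neg_zero, zero_div]

/-- If `l < 1` and `Re μ > 0`, then `μ/(1-l)` is a fixed point of `lX+μ` inside the half-plane. Its
orbit is constant in the disk and cannot converge to `w` on the circle. -/
theorem one_le_or_re_eq_zero_of_isDenjoyWolffPoint (hM : MapsDisk M)
    (hDW : IsDenjoyWolffPoint (mobius M) w) (hw : ‖w‖ = 1)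
    (hμ : 0 ≤ μ.re) (h : M = k • halfPlaneMatrix w l μ) : 1 ≤ l ∨ μ.re = 0 := by
  by_contra! hcon
  obtain ⟨hl1, hμ0⟩ := hcon
  have hμ' : 0 < μ.re := lt_of_le_of_ne hμ hμ0.symm
  have h1l : 0 < 1 - l := by linarith
  set X : ℂ := μ / ((1 - l : ℝ) : ℂ) with hX
  have hXre : 0 < X.re := by
    rw [hX, Complex.div_ofReal_re]
    exact div_pos hμ' h1l
  have hXeq : (l : ℂ) * X + μ = X := by
    have : ((1 - l : ℝ) : ℂ) * X = μ :=
      mul_div_cancel₀ _ (Complex.ofReal_ne_zero.mpr h1l.ne')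
    push_cast at this
    linear_combination -this
  have hlt : ‖w * (X - 1)‖ < ‖X + 1‖ := by
    have := norm_sq_sub_norm_sq_halfPlane hw X 1
    rw [map_one, mul_one] at this
    exact lt_of_pow_lt_pow_left₀ 2 (norm_nonneg _) (by linarith)
  have hpos : 0 < ‖X + 1‖ := (norm_nonneg _).trans_lt hlt
  have hX1 : X + 1 ≠ 0 := norm_pos_iff.mp hpos
  have hz : ‖w * (X - 1) / (X + 1)‖ < 1 := by rwa [norm_div, div_lt_one hpos]
  have hfix : mobius M (w * (X - 1) / (X + 1)) = w * (X - 1) / (X + 1) := by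
    rw [hM.mobius_eq_iff hz.le, h]
    simp only [halfPlaneMatrix, Matrix.smul_apply, smul_eq_mul, Matrix.of_apply, Matrix.cons_val',
      Matrix.cons_val_zero, Matrix.cons_val_one, Matrix.cons_val_fin_one]
    clear_value X
    field_simp
    linear_combination (4 * k * w ^ 2) * hXeq
  have := hDW.eq_of_fixed hz hfix
  rw [this, hw] at hz
  exact lt_irrefl _ hz

theorem deriv_mobius_eq_inv (hM : MapsDisk M) (hw : ‖w‖ = 1) (hk : k ≠ 0) (hl : 0 < l)
    (h : M = k • halfPlaneMatrix w l μ) : deriv (mobius M) w = (l : ℂ)⁻¹ := by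
  have hw0 : w ≠ 0 := norm_ne_zero_iff.mp (by rw [hw]; exact one_ne_zero)
  have hl0 : (l : ℂ) ≠ 0 := Complex.ofReal_ne_zero.mpr hl.ne'
  have h0 := hM.denom_ne_zero hw.le
  have h1 : HasDerivAt (fun z => M 0 0 * z + M 0 1) (M 0 0) w := by
    simpa using ((hasDerivAt_id w).const_mul (M 0 0)).add_const (M 0 1)
  have h2 : HasDerivAt (fun z => M 1 0 * z + M 1 1) (M 1 0) w := by
    simpa using ((hasDerivAt_id w).const_mul (M 1 0)).add_const (M 1 1)
  have h3 : deriv (mobius M) w = _ := (h1.div h2 h0).deriv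
  have e : M 1 0 * w + M 1 1 = 2 * k * l * w := by
    rw [h]
    simp [halfPlaneMatrix]
    ring
  have e2 : M 0 0 * w + M 0 1 = 2 * k * l * w ^ 2 := by
    rw [h]
    simp [halfPlaneMatrix]
    ring
  have e3 : M 0 0 - w * M 1 0 = 2 * k * w := by
    rw [h]
    simp [halfPlaneMatrix]
    ring
  rw [h3, e, e2]
  field_simp
  linear_combination e3

theorem posinormal_iff_of_norm_eq_one (hM : MapsDisk M) (hDW : IsDenjoyWolffPoint (mobius M) w)
    (hw : ‖w‖ = 1) :
    IsPosinormal (compositionOperator hM.toDisc) ↔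
      IsDiskAutomorphism (mobius M) ∨
      (∃ α : ℂ, ‖α‖ < 1 ∧ ‖w‖ < ‖α‖ ∧ IsConjugateOfDilation (mobius M) w α) ∨
      (‖w‖ = 1 ∧ deriv (mobius M) w = 1 ∧ VanishesInDisk (mobius M)) ∨
      ((∃ p : ℂ, ‖p‖ < 1 ∧ mobius M p = p) ∧ (∃ q : ℂ, ‖q‖ = 1 ∧ mobius M q = q) ∧
        VanishesInDisk (mobius M)) := by
  have hw0 : w ≠ 0 := norm_ne_zero_iff.mp (by rw [hw]; exact one_ne_zero)
  obtain ⟨k, l, μ, hk, hl, hμ, h⟩ := exists_eq_smul_halfPlaneMatrix hM hw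
    ((hM.mobius_eq_iff hw.le w).mp hDW.fixed)
  have hl0 : (l : ℂ) ≠ 0 := Complex.ofReal_ne_zero.mpr hl.ne'
  -- In the half-plane `χ` is `l²X + μ - lμ̄`, so only the sign of `Re(μ - lμ̄)` matters.
  have hX : MapsDisk (mulSharpAdjugate M) ↔ 0 ≤ μ.re * (1 - l) := by
    rw [h, mulSharpAdjugate_smul, MapsDisk.smul_iff (mul_ne_zero hk ((map_ne_zero _).mpr hk)),
      mulSharpAdjugate_halfPlaneMatrix hw,
      MapsDisk.smul_iff (mul_ne_zero two_ne_zero ((map_ne_zero _).mpr hw0)),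
      mapsDisk_halfPlaneMatrix_iff hw (pow_ne_zero _ hl0), ← Complex.ofReal_pow, Complex.ofReal_im,
      Complex.ofReal_re, Complex.sub_re, Complex.re_ofReal_mul, Complex.conj_re]
    have e : μ.re - l * μ.re = μ.re * (1 - l) := by ring
    rw [e]
    exact ⟨fun h => h.2.2, fun h => ⟨rfl, by positivity, h⟩⟩
  constructor
  · intro hpos
    obtain ⟨hv, hχ⟩ := hM.isPosinormal_compositionOperator_iff.mp hpos
    rw [← hM.vanishesInDisk_mobius_iff] at hv
    rw [hX] at hχ
    by_cases hμ0 : μ.re = 0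
    · exact Or.inl (isDiskAutomorphism_of_halfPlane hM hw hk hl h hμ0)
    · have hl1 := (one_le_or_re_eq_zero_of_isDenjoyWolffPoint hM hDW hw hμ h).resolve_right hμ0
      have hμ' : 0 < μ.re := lt_of_le_of_ne hμ (Ne.symm hμ0)
      have hl2 : l = 1 := by
        have := nonneg_of_mul_nonneg_right hχ hμ'
        linarith
      refine Or.inr (Or.inr (Or.inl ⟨hw, ?_, hv⟩))
      rw [deriv_mobius_eq_inv hM hw hk hl h, hl2]
      simp
  · rintro (hauto | ⟨α, hα, hwα, -⟩ | ⟨-, hder, hv⟩ | ⟨⟨p, hp, hpfix⟩, -⟩)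
    · exact (hM.isPosinormal_and_isCoposinormal_of_adjugate
        (hM.isDiskAutomorphism_mobius_iff.mp hauto)).1
    · linarith
    · rw [deriv_mobius_eq_inv hM hw hk hl h, inv_eq_one] at hder
      have hl1 : l = 1 := by exact_mod_cast hder
      refine hM.isPosinormal_compositionOperator (hM.vanishesInDisk_mobius_iff.mp hv) (hX.mpr ?_)
      rw [hl1, sub_self, mul_zero]
    · rw [hDW.eq_of_fixed hp hpfix, hw] at hp
      exact absurd hp (lt_irrefl _)

theorem coposinormal_of_norm_eq_one (hM : MapsDisk M) (hDW : IsDenjoyWolffPoint (mobius M) w)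
    (hw : ‖w‖ = 1) : IsCoposinormal (compositionOperator hM.toDisc) := by
  have hw0 : w ≠ 0 := norm_ne_zero_iff.mp (by rw [hw]; exact one_ne_zero)
  obtain ⟨k, l, μ, hk, hl, hμ, h⟩ := exists_eq_smul_halfPlaneMatrix hM hw
    ((hM.mobius_eq_iff hw.le w).mp hDW.fixed)
  have hl0 : (l : ℂ) ≠ 0 := Complex.ofReal_ne_zero.mpr hl.ne'
  have hl2 : (l : ℂ) ^ 2 ≠ 0 := pow_ne_zero _ hl0
  refine hM.isCoposinormal_compositionOperator ?_
  have hk2 : 2 * (l : ℂ) ^ 2 * conj w ≠ 0 :=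
    mul_ne_zero (mul_ne_zero two_ne_zero hl2) ((map_ne_zero _).mpr hw0)
  have hDl := one_le_or_re_eq_zero_of_isDenjoyWolffPoint hM hDW hw hμ h
  rw [h, sharpMulAdjugate_smul, MapsDisk.smul_iff (mul_ne_zero hk ((map_ne_zero _).mpr hk)),
    sharpMulAdjugate_halfPlaneMatrix hw hl.ne', MapsDisk.smul_iff hk2,
    mapsDisk_halfPlaneMatrix_iff hw (inv_ne_zero hl2), ← Complex.ofReal_pow, ← Complex.ofReal_inv,
    Complex.ofReal_im, Complex.ofReal_re, Complex.div_ofReal_re, Complex.sub_re,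
    Complex.re_ofReal_mul, Complex.conj_re]
  refine ⟨rfl, by positivity, div_nonneg ?_ (by positivity)⟩
  rcases hDl with h1 | h1
  · nlinarith
  · rw [h1]; simp

end Boundary

/-! ### The main theorem -/

theorem IsLinearFractionalSelfmap.exists_mapsDisk {φ : ℂ → ℂ} (hφ : IsLinearFractionalSelfmap φ) :
    ∃ M, MapsDisk M ∧ φ = mobius M := by
  obtain ⟨a, b, c, d, hdet, hpole, hφe⟩ := hφ.exists_eq
  refine ⟨!![a, b; c, d], MapsDisk.of_forall_norm_lt_one ?_ fun z hz => ?_, hφe⟩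
  · rwa [Matrix.det_fin_two_of]
  · have h := hφ.norm_lt_one z hz
    rw [hφe, linearFractional, norm_div, div_lt_one (norm_pos_iff.mpr (hpole z hz))] at h
    exact h

theorem mainTheorem1 (φ : ℂ → ℂ) (hφ : IsLinearFractionalSelfmap φ) :
    (∀ (f : HardySpace) (z : 𝔻), compositionOperator hφ.toDisc f z = f (hφ.toDisc z)) ∧
    (IsDiskAutomorphism φ →
      IsPosinormal (compositionOperator hφ.toDisc) ∧
      IsCoposinormal (compositionOperator hφ.toDisc)) ∧
    ∀ w : ℂ, IsDenjoyWolffPoint φ w →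
      (IsPosinormal (compositionOperator hφ.toDisc) ↔
        IsDiskAutomorphism φ ∨
        (∃ α : ℂ, ‖α‖ < 1 ∧ ‖w‖ < ‖α‖ ∧ IsConjugateOfDilation φ w α) ∨
        (‖w‖ = 1 ∧ deriv φ w = 1 ∧ VanishesInDisk φ) ∨
        ((∃ p : ℂ, ‖p‖ < 1 ∧ φ p = p) ∧ (∃ q : ℂ, ‖q‖ = 1 ∧ φ q = q) ∧ VanishesInDisk φ)) ∧
      (IsCoposinormal (compositionOperator hφ.toDisc) ↔
        IsDiskAutomorphism φ ∨
        ‖w‖ = 1 ∨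
        (‖w‖ < 1 ∧ ∃ α : ℂ, 0 < ‖α‖ ∧ ‖α‖ < 1 ∧ IsConjugateOfDilation φ w α)) := by
  obtain ⟨M, hM, rfl⟩ := hφ.exists_mapsDisk
  have e : hφ.toDisc = hM.toDisc := rfl
  rw [e]
  refine ⟨hM.compositionOperator_apply, fun hauto =>
    hM.isPosinormal_and_isCoposinormal_of_adjugate (hM.isDiskAutomorphism_mobius_iff.mp hauto),
    fun w hDW => ?_⟩
  rcases hDW.norm_le_one.lt_or_eq with hw | hw
  · exact ⟨posinormal_iff_of_norm_lt_one hM hDW hw, coposinormal_iff_of_norm_lt_one hM hDW hw⟩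
  · exact ⟨posinormal_iff_of_norm_eq_one hM hDW hw, fun _ => Or.inr (Or.inl hw),
      fun _ => coposinormal_of_norm_eq_one hM hDW hw⟩
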